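/- Let $\gamma=(\gamma_{ij})$ be a real symmetric $3\times3$ matrix function on $\mathbb R^3$ with $\gamma_{ij}\in L^\infty(\mathbb R^3)$ and $\gamma(x)\xi\cdot\xi\ge c_0|\xi|^2$ for a.e. $x$ and all $\xi\in\mathbb R^3$, with a constant $c_0>0$; put $L_\gamma u=\operatorname{div}(\gamma\nabla u)$. Let $D\subset\mathbb R^3$ be a nonempty bounded set with $\mathbb R^3\setminus D$ connected, such that $\gamma=I_3$ in $\mathbb R^3\setminus D$ and one of the following holds: $(\mathrm M)_+$: there is $c>1$ with $\gamma(x)\ge cI_3$ for $x\in D$; or $(\mathrm M)_-$: there is $c<1$ with $\gamma(x)\le cI_3$ for $x\in D$. Let $B\subset\mathbb R^3$ be a nonempty open set with $\overline B\cap\overline D=\emptyset$, and let $f\in L^2(\mathbb R^3)$ be real valued with $\operatorname{supp}f\subset\overline B$ such that, for some constant $c_1>0$, either $f\ge c_1$ on $B$ or $-f\ge c_1$ on $B$. (Pointwise relations between $L^\infty$ or $L^2$ functions are understood almost everywhere.) Let $T>0$ and let $u$ be the weak solution of $$(\partial_t^2-L_\gamma)u=0\ \text{ in }(0,T)\times\mathbb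 R^3,\qquad u(0,\cdot)=0,\quad \partial_tu(0,\cdot)=f,$$ that is, $u\in L^2(0,T;H^1(\mathbb R^3))$, $\partial_tu\in L^2(0,T;L^2(\mathbb R^3))$, $\partial_t^2u\in L^2(0,T;(H^1(\mathbb R^3))')$, $\langle\partial_t^2u(t,\cdot),\phi\rangle+\int_{\mathbb R^3}\gamma\nabla_xu(t,x)\cdot\nabla\phi(x)\,dx=0$ for a.e. $t\in(0,T)$ and all $\phi\in H^1(\mathbb R^3)$, and the initial values are attained by the continuous representatives $u\in C([0,T];L^2(\mathbb R^3))$ and $\partial_tu\in C([0,T];(H^1(\mathbb R^3))')$. For $\tau\ge1$ let $v(\cdot;\tau)\in H^1(\mathbb R^3)$ be the weak solution of $(\Delta-\tau^2)v+f=0$ in $\mathbb R^3$, put $w(x;\tau)=\int_0^Te^{-\tau t}u(t,x)\,dt$, and define the indicator function $$I_\tau=\int_{\mathbb R^3}f(x)\,\bigl(w(x;\tau)-v(x;\tau)\bigr)\,dx .$$ Put $\operatorname{dist}(D,B)=\inf_{x\in D,\,y\in B}|x-y|$. A set $A\subset\mathbb R^3$ satisfies condition (C) if for every $x\in\partial A$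 there are a unit vector $n$, $h>0$ and $\theta\in(0,\pi]$ such that $\{y:|y-x|\le h,\ (y-x)\cdot n\ge|y-x|\cos\theta\}\setminus\{x\}\subset A$. Suppose that either (a) $D$ has $C^1$ boundary and $B$ satisfies (C), or (b) $D$ and $B$ satisfy (C) and $B$ is convex. Then: (i) if $T<2\operatorname{dist}(D,B)$, then $\lim_{\tau\to\infty}e^{\tau T}I_\tau=0$; (ii) if $T>2\operatorname{dist}(D,B)$, then $\lim_{\tau\to\infty}e^{\tau T}I_\tau=-\infty$ under $(\mathrm M)_+$, and $\lim_{\tau\to\infty}e^{\tau T}I_\tau=+\infty$ under $(\mathrm M)_-$; (iii) if $T>2\operatorname{dist}(D,B)$, then $\displaystyle\lim_{\tau\to\infty}\frac1\tau\log|I_\tau|=-2\operatorname{dist}(D,B)$. -/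

import Mathlib

open MeasureTheory Filter Topology Set
open scoped ContDiff ENNReal Matrix

noncomputable section

namespace Enclosure

/-- The Euclidean space `ℝ³`. -/
abbrev E3 : Type := EuclideanSpace ℝ (Fin 3)

/-- `L²(ℝ³)`, real valued. -/
abbrev L2 : Type := Lp ℝ 2 (volume : Measure E3)

/-- `L²(ℝ³; ℝ³)`. -/
abbrev L2Vec : Type := Lp E3 2 (volume : Measure E3)

/-! ### The Sobolev space `H¹(ℝ³)` -/

/-- `g ∈ L²(ℝ³; ℝ³)` is the weak gradient of `u ∈ L²(ℝ³)`. -/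
def IsWeakGradient (u : L2) (g : L2Vec) : Prop :=
  ∀ φ : E3 → ℝ, ContDiff ℝ ∞ φ → HasCompactSupport φ → ∀ i : Fin 3,
    ∫ x, u x * fderiv ℝ φ x (EuclideanSpace.single i 1) = - ∫ x, g x i * φ x

theorem memLp_test {φ : E3 → ℝ} (h : ContDiff ℝ ∞ φ) (hc : HasCompactSupport φ) :
    MemLp φ 2 (volume : Measure E3) :=
  h.continuous.memLp_of_hasCompactSupport hc

theorem memLp_test_deriv {φ : E3 → ℝ} (h : ContDiff ℝ ∞ φ) (hc : HasCompactSupport φ) (e : E3) :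
    MemLp (fun x => fderiv ℝ φ x e) 2 (volume : Measure E3) := by
  refine Continuous.memLp_of_hasCompactSupport ?_ ?_
  · exact (h.continuous_fderiv (by simp)).clm_apply continuous_const
  · exact hc.fderiv_apply (𝕜 := ℝ) e

theorem memLp_coord (g : L2Vec) (i : Fin 3) :
    MemLp (fun x => g x i) 2 (volume : Measure E3) :=
  (EuclideanSpace.proj i : E3 →L[ℝ] ℝ).comp_memLp' (Lp.memLp g)

theorem IsWeakGradient.add {u₁ u₂ : L2} {g₁ g₂ : L2Vec} (h₁ : IsWeakGradient u₁ g₁)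
    (h₂ : IsWeakGradient u₂ g₂) : IsWeakGradient (u₁ + u₂) (g₁ + g₂) := by
  intro φ hφ hc i
  have e₁ : ∫ x, (u₁ + u₂ : L2) x * fderiv ℝ φ x (EuclideanSpace.single i 1)
      = ∫ x, (u₁ x * fderiv ℝ φ x (EuclideanSpace.single i 1)
        + u₂ x * fderiv ℝ φ x (EuclideanSpace.single i 1)) := by
    refine integral_congr_ae ?_
    filter_upwards [Lp.coeFn_add u₁ u₂] with x hx
    rw [hx, Pi.add_apply, add_mul]
  have e₂ : ∫ x, (g₁ + g₂ : L2Vec) x i * φ x = ∫ x, (g₁ x i * φ x + g₂ x i * φ x) := by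
    refine integral_congr_ae ?_
    filter_upwards [Lp.coeFn_add g₁ g₂] with x hx
    rw [hx, Pi.add_apply, PiLp.add_apply, add_mul]
  rw [e₁, e₂, integral_add, integral_add, h₁ φ hφ hc i, h₂ φ hφ hc i, neg_add]
  · exact (memLp_coord g₁ i).integrable_mul (memLp_test hφ hc)
  · exact (memLp_coord g₂ i).integrable_mul (memLp_test hφ hc)
  · exact (Lp.memLp u₁).integrable_mul (memLp_test_deriv hφ hc _)
  · exact (Lp.memLp u₂).integrable_mul (memLp_test_deriv hφ hc _)

theorem IsWeakGradient.smul (c : ℝ) {u : L2} {g : L2Vec} (h : IsWeakGradient u g) :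
    IsWeakGradient (c • u) (c • g) := by
  intro φ hφ hc i
  have e₁ : ∫ x, (c • u : L2) x * fderiv ℝ φ x (EuclideanSpace.single i 1)
      = ∫ x, c * (u x * fderiv ℝ φ x (EuclideanSpace.single i 1)) := by
    refine integral_congr_ae ?_
    filter_upwards [Lp.coeFn_smul c u] with x hx
    rw [hx, Pi.smul_apply, smul_eq_mul, mul_assoc]
  have e₂ : ∫ x, (c • g : L2Vec) x i * φ x = ∫ x, c * (g x i * φ x) := by
    refine integral_congr_ae ?_
    filter_upwards [Lp.coeFn_smul c g] with x hx
    rw [hx, Pi.smul_apply, PiLp.smul_apply, smul_eq_mul, mul_assoc]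
  rw [e₁, e₂, integral_const_mul, integral_const_mul, h φ hφ hc i, mul_neg]

/-- The pairs `(u, ∇u)` of an `L²` function and its weak gradient in `L²`, normed by
`‖u‖² = ‖u‖²_{L²} + ‖∇u‖²_{L²}`. The second component is determined by the first. -/
def h1Submodule : Submodule ℝ (WithLp 2 (L2 × L2Vec)) where
  carrier := {p | IsWeakGradient p.fst p.snd}
  add_mem' h₁ h₂ := IsWeakGradient.add h₁ h₂
  zero_mem' := by
    have h : IsWeakGradient (0 : L2) (0 : L2Vec) := by
      intro φ _ _ i
      simp
    exact h
  smul_mem' c _ h := IsWeakGradient.smul c h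

/-- The Sobolev space `H¹(ℝ³)`. -/
def H1 : Type := h1Submodule

instance : NormedAddCommGroup H1 := inferInstanceAs (NormedAddCommGroup h1Submodule)

instance : InnerProductSpace ℝ H1 := inferInstanceAs (InnerProductSpace ℝ h1Submodule)

/-- The inclusion `H¹(ℝ³) ⊂ L²(ℝ³)`. -/
def toL2 : H1 →L[ℝ] L2 := (WithLp.fstL 2 ℝ L2 L2Vec).comp h1Submodule.subtypeL

/-- The gradient `∇ : H¹(ℝ³) → L²(ℝ³; ℝ³)`. -/
def grad : H1 →L[ℝ] L2Vec := (WithLp.sndL 2 ℝ L2 L2Vec).comp h1Submodule.subtypeL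

/-- The dual space `(H¹(ℝ³))'`. -/
abbrev H1Dual : Type := H1 →L[ℝ] ℝ

/-- The inclusion `L²(ℝ³) ⊂ (H¹(ℝ³))'`, `g ↦ (φ ↦ ∫ g φ dx)`. -/
def toH1Dual (g : L2) : H1Dual := (innerSL ℝ g).comp toL2

/-! ### Coefficients, the wave equation and the reduced equation -/

/-- `γ` is a symmetric matrix function with `L^∞` entries, and `γ(x) ≥ c₀` for almost every `x`
with a constant `c₀ > 0`. -/
structure IsCoefficient (γ : E3 → Matrix (Fin 3) (Fin 3) ℝ) : Prop where
  memLp : ∀ i j, MemLp (fun x => γ x i j) ∞ (volume : Measure E3)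
  symm : ∀ᵐ x : E3, (γ x).IsSymm
  elliptic : ∃ c₀ : ℝ, 0 < c₀ ∧ ∀ᵐ x : E3, ∀ ξ : E3, c₀ * ‖ξ‖ ^ 2 ≤ (γ x *ᵥ ξ.ofLp) ⬝ᵥ ξ.ofLp

/-- The form `∫ γ(x) ∇u · ∇φ dx`, the weak form of `-L_γ = -div (γ ∇ ·)`. -/
def form (γ : E3 → Matrix (Fin 3) (Fin 3) ℝ) (u φ : H1) : ℝ :=
  ∫ x, (γ x *ᵥ (grad u x).ofLp) ⬝ᵥ (grad φ x).ofLp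

/-- `g'` is the weak (distributional) derivative of the `X`-valued function `g` on `(0, T)`. -/
def IsWeakTimeDeriv {X : Type*} [NormedAddCommGroup X] [NormedSpace ℝ X] (T : ℝ)
    (g g' : ℝ → X) : Prop :=
  ∀ ψ : ℝ → ℝ, ContDiff ℝ ∞ ψ → HasCompactSupport ψ → tsupport ψ ⊆ Ioo 0 T →
    ∫ t in Ioo 0 T, deriv ψ t • g t = - ∫ t in Ioo 0 T, ψ t • g' t

/-- The representative of `g` on `(0, T)` that is continuous on `[0, T]` has the value `a` at
time `0`. -/
def HasInitialValue {X : Type*} [NormedAddCommGroup X] (T : ℝ) (g : ℝ → X) (a : X) : Prop :=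
  ∃ G : ℝ → X, ContinuousOn G (Icc 0 T) ∧
    (∀ᵐ t ∂(volume.restrict (Ioo 0 T)), G t = g t) ∧ G 0 = a

/-- `u` is a weak solution of `(∂_t² - L_γ) u = 0` in `(0, T) × ℝ³`, `u(0) = 0`, `∂_t u(0) = f`:
`u ∈ L²(0, T; H¹)`, `∂_t u ∈ L²(0, T; L²)`, `∂_t² u ∈ L²(0, T; (H¹)')`, the equation holds in
`(H¹)'` for almost every `t`, and the initial values are attained by the continuous
representatives of `u` in `L²` and of `∂_t u` in `(H¹)'`. -/
def IsWeakWaveSolution (γ : E3 → Matrix (Fin 3) (Fin 3) ℝ) (T : ℝ) (f : L2)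
    (u : ℝ → H1) : Prop :=
  ∃ (ut : ℝ → L2) (utt : ℝ → H1Dual),
    MemLp u 2 (volume.restrict (Ioo 0 T)) ∧
    MemLp ut 2 (volume.restrict (Ioo 0 T)) ∧
    MemLp utt 2 (volume.restrict (Ioo 0 T)) ∧
    IsWeakTimeDeriv T (fun t => toL2 (u t)) ut ∧
    IsWeakTimeDeriv T (fun t => toH1Dual (ut t)) utt ∧
    (∀ᵐ t ∂(volume.restrict (Ioo 0 T)), ∀ φ : H1, utt t φ + form γ (u t) φ = 0) ∧
    HasInitialValue T (fun t => toL2 (u t)) 0 ∧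
    HasInitialValue T (fun t => toH1Dual (ut t)) (toH1Dual f)

/-- `v ∈ H¹(ℝ³)` is the weak solution of `(L_γ - τ²) v + f = 0` in `ℝ³`. -/
def IsReducedSolution (γ : E3 → Matrix (Fin 3) (Fin 3) ℝ) (τ : ℝ) (f : L2) (v : H1) : Prop :=
  ∀ φ : H1, form γ v φ + τ ^ 2 * ∫ x, toL2 v x * toL2 φ x = ∫ x, f x * toL2 φ x

/-- `w(·; τ) = ∫₀ᵀ e^{-τ t} u(t, ·) dt`, as an element of `L²(ℝ³)`. -/
def truncLaplace (T : ℝ) (u : ℝ → H1) (τ : ℝ) : L2 :=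
  ∫ t in (0 : ℝ)..T, Real.exp (-τ * t) • toL2 (u t)

/-- The indicator function `I_τ = ∫ f(x) (w(x; τ) - v(x; τ)) dx`. -/
def indicatorFn (T : ℝ) (f : L2) (u : ℝ → H1) (v : ℝ → H1) (τ : ℝ) : ℝ :=
  ∫ x, f x * (truncLaplace T u τ x - toL2 (v τ) x)

/-! ### Inclusions and emission sets -/

/-- `(M)₊`: `inf_{x ∈ D} γ(x) > I₃`. -/
def MonotonePlus (γ : E3 → Matrix (Fin 3) (Fin 3) ℝ) (D : Set E3) : Prop :=
  ∃ c : ℝ, 1 < c ∧ ∀ᵐ x : E3, x ∈ D → ∀ ξ : E3, c * ‖ξ‖ ^ 2 ≤ (γ x *ᵥ ξ.ofLp) ⬝ᵥ ξ.ofLp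

/-- `(M)₋`: `sup_{x ∈ D} γ(x) < I₃`. -/
def MonotoneMinus (γ : E3 → Matrix (Fin 3) (Fin 3) ℝ) (D : Set E3) : Prop :=
  ∃ c : ℝ, c < 1 ∧ ∀ᵐ x : E3, x ∈ D → ∀ ξ : E3, (γ x *ᵥ ξ.ofLp) ⬝ᵥ ξ.ofLp ≤ c * ‖ξ‖ ^ 2

/-- The emission condition: `supp f ⊂ closure B`, and `f ≥ c₁` on `B` or `-f ≥ c₁` on `B` for some
constant `c₁ > 0`. -/
def EmissionCondition (B : Set E3) (f : L2) : Prop :=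
  (∀ᵐ x : E3, x ∉ closure B → f x = 0) ∧
  ∃ c₁ : ℝ, 0 < c₁ ∧ ((∀ᵐ x : E3, x ∈ B → c₁ ≤ f x) ∨ (∀ᵐ x : E3, x ∈ B → c₁ ≤ - f x))

/-- The cone with vertex `x`, direction `n`, radius `h` and opening angle `θ`. -/
def cone (x n : E3) (h θ : ℝ) : Set E3 :=
  {y | ‖y - x‖ ≤ h ∧ ‖y - x‖ * Real.cos θ ≤ inner ℝ (y - x) n}

/-- Condition (C). Opening angles are at most `π`; for larger `θ` the set `cone x n h θ` is no
cone of opening angle `θ` (it is a segment for `θ = 2π`). -/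
def ConeCondition (D : Set E3) : Prop :=
  ∀ x ∈ frontier D, ∃ (n : E3) (h θ : ℝ), ‖n‖ = 1 ∧ 0 < h ∧ 0 < θ ∧ θ ≤ Real.pi ∧
    cone x n h θ \ {x} ⊆ D

/-- `D` has `C¹` boundary: near each boundary point, `D` is, up to boundary points, the set
`{ρ < 0}` for a `C¹` function `ρ` with non-vanishing differential. (For open `D`, this is
`D = {ρ < 0}` near the boundary point.) -/
def HasC1Boundary (D : Set E3) : Prop :=
  ∀ x ∈ frontier D, ∃ (r : ℝ) (ρ : E3 → ℝ), 0 < r ∧ ContDiffOn ℝ 1 ρ (Metric.ball x r) ∧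
    (∀ y ∈ Metric.ball x r, fderiv ℝ ρ y ≠ 0) ∧
    ∀ y ∈ Metric.ball x r, (ρ y < 0 → y ∈ D) ∧ (0 < ρ y → y ∉ D)

/-- `dist(D, B) = inf_{x ∈ D, y ∈ B} |x - y|`. -/
def setDist (D B : Set E3) : ℝ := sInf {r : ℝ | ∃ x ∈ D, ∃ y ∈ B, r = dist x y}

end Enclosure

end

open Enclosure

/-!
Testing the equations of `w` and `v` with each other gives energy identities that trap `∓I_τ`, up
to a term of size `e^{-τT}/τ` from the truncation at time `T`, between constant multiples of
`∫_D |∇v|²`, whose rate is read off from the free equation alone. From above, testing that equation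
with `e^{-2κ|x - x₀|} v` for `κ` slightly below `τ` (Agmon's weighted estimate) bounds the
integral over a small ball around `x₀ ∈ D` by nearly `e^{-2τ dist(x₀, B)}`, and finitely many balls
cover `D`. From below, testing it with a cut-off of the Yukawa potential `e^{-τr}/r` centred at an
interior point of `D` close to `B` bounds an integral of `f` against a positive kernel by the norm
of `v` near that point, and the sign of `f` on `B` excludes cancellation.
-/

open scoped Laplacian

noncomputable section

namespace Enclosure

section L2Pairing

variable {α E F : Type*} [MeasurableSpace α] {μ : Measure α} [NormedAddCommGroup E]
  [NormedAddCommGroup F]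

theorem integral_mul_eq_inner (f g : Lp ℝ 2 μ) : ∫ x, f x * g x ∂μ = inner ℝ f g := by
  simp only [L2.inner_def, RCLike.inner_apply, conj_trivial, mul_comm]

theorem integrable_norm_mul_norm (g : Lp E 2 μ) (h : Lp F 2 μ) :
    Integrable (fun x => ‖g x‖ * ‖h x‖) μ :=
  (Lp.memLp g).norm.integrable_mul (Lp.memLp h).norm

theorem integrable_norm_sq (g : Lp E 2 μ) : Integrable (fun x => ‖g x‖ ^ 2) μ := by
  simpa only [sq] using integrable_norm_mul_norm g g

theorem integral_norm_mul_norm_le (g : Lp E 2 μ) (h : Lp F 2 μ) :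
    ∫ x, ‖g x‖ * ‖h x‖ ∂μ ≤ ‖g‖ * ‖h‖ := by
  have hg := (Lp.memLp g).norm
  have hh := (Lp.memLp h).norm
  calc ∫ x, ‖g x‖ * ‖h x‖ ∂μ = inner ℝ (hg.toLp _) (hh.toLp _) := by
        rw [← integral_mul_eq_inner]
        refine integral_congr_ae ?_
        filter_upwards [hg.coeFn_toLp, hh.coeFn_toLp] with x h₁ h₂
        rw [h₁, h₂]
    _ ≤ ‖hg.toLp _‖ * ‖hh.toLp _‖ := real_inner_le_norm _ _
    _ = ‖g‖ * ‖h‖ := by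
        rw [Lp.norm_toLp, Lp.norm_toLp, eLpNorm_norm, eLpNorm_norm, ← Lp.norm_def, ← Lp.norm_def]

theorem norm_sq_eq_integral [InnerProductSpace ℝ E] (g : Lp E 2 μ) :
    ‖g‖ ^ 2 = ∫ x, ‖g x‖ ^ 2 ∂μ := by
  simp only [← real_inner_self_eq_norm_sq, L2.inner_def]

theorem mul_setIntegral_norm_sq_le {S : Set α} (hS : MeasurableSet S) (k : ℝ) (g : Lp E 2 μ)
    {q : α → ℝ} (hq : Integrable q μ)
    (hle : ∀ᵐ x ∂μ, S.indicator (fun _ => k) x * ‖g x‖ ^ 2 ≤ q x) :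
    k * ∫ x in S, ‖g x‖ ^ 2 ∂μ ≤ ∫ x, q x ∂μ := by
  rw [← integral_const_mul, ← integral_indicator hS]
  refine integral_mono_ae (((integrable_norm_sq g).const_mul k).indicator hS) hq ?_
  filter_upwards [hle] with x hx
  rwa [indicator_mul_left]

end L2Pairing

/-! ### Elements of `H¹(ℝ³)` -/

/-- The element of `H¹` given by a function and its weak gradient. -/
def H1.mk (u : L2) (g : L2Vec) (h : IsWeakGradient u g) : H1 :=
  ⟨WithLp.toLp 2 (u, g), h⟩

theorem isWeakGradient_grad (u : H1) : IsWeakGradient (toL2 u) (grad u) := u.2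

theorem norm_sq_H1 (u : H1) : ‖u‖ ^ 2 = ‖toL2 u‖ ^ 2 + ‖grad u‖ ^ 2 :=
  WithLp.prod_norm_sq_eq_of_L2 (u.1 : WithLp 2 (L2 × L2Vec))

theorem norm_grad_le (u : H1) : ‖grad u‖ ≤ ‖u‖ := by
  refine (sq_le_sq₀ (norm_nonneg _) (norm_nonneg _)).1 ?_
  rw [norm_sq_H1]
  exact le_add_of_nonneg_left (sq_nonneg _)

theorem toH1Dual_apply (g : L2) (φ : H1) : toH1Dual g φ = inner ℝ g (toL2 φ) := rfl

theorem continuous_integral_mul {ψ : E3 → ℝ} (hψ : MemLp ψ 2 (volume : Measure E3)) :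
    Continuous fun u : L2 => ∫ x, u x * ψ x := by
  have h : (fun u : L2 => ∫ x, u x * ψ x) = fun u => inner ℝ u (hψ.toLp ψ) := by
    funext u
    rw [← integral_mul_eq_inner]
    refine integral_congr_ae ?_
    filter_upwards [hψ.coeFn_toLp] with x hx
    rw [hx]
  rw [h]
  fun_prop

theorem continuous_integral_coord_mul {ψ : E3 → ℝ} (hψ : MemLp ψ 2 (volume : Measure E3))
    (i : Fin 3) : Continuous fun g : L2Vec => ∫ x, g x i * ψ x := by
  have h : (fun g : L2Vec => ∫ x, g x i * ψ x)
      = fun g => ∫ x, (EuclideanSpace.proj i : E3 →L[ℝ] ℝ).compLp g x * ψ x := by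
    funext g
    refine integral_congr_ae ?_
    filter_upwards [(EuclideanSpace.proj i : E3 →L[ℝ] ℝ).coeFn_compLp g] with x hx
    rw [hx, PiLp.proj_apply]
  rw [h]
  exact (continuous_integral_mul hψ).comp
    ((EuclideanSpace.proj i : E3 →L[ℝ] ℝ).compLpL 2 volume).continuous

theorem isClosed_h1Submodule : IsClosed (h1Submodule : Set (WithLp 2 (L2 × L2Vec))) := by
  have h : (h1Submodule : Set (WithLp 2 (L2 × L2Vec))) =
      ⋂ (φ : E3 → ℝ) (_ : ContDiff ℝ ∞ φ) (_ : HasCompactSupport φ) (i : Fin 3),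
        {p | ∫ x, p.fst x * fderiv ℝ φ x (EuclideanSpace.single i 1)
          = - ∫ x, p.snd x i * φ x} := by
    ext p
    simp only [mem_iInter]
    rfl
  rw [h]
  refine isClosed_iInter fun φ => isClosed_iInter fun hφ => isClosed_iInter fun hc =>
    isClosed_iInter fun i => isClosed_eq ?_ ?_
  · exact (continuous_integral_mul (memLp_test_deriv hφ hc _)).comp
      (WithLp.fstL 2 ℝ L2 L2Vec).continuous
  · exact ((continuous_integral_coord_mul (memLp_test hφ hc) i).comp
      (WithLp.sndL 2 ℝ L2 L2Vec).continuous).neg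

instance : CompleteSpace H1 :=
  isClosed_h1Submodule.completeSpace_coe

/-! ### Test functions and multipliers -/

theorem gradient_apply_coord {ι : Type*} [Fintype ι] [DecidableEq ι]
    (m : EuclideanSpace ℝ ι → ℝ) (x : EuclideanSpace ℝ ι) (i : ι) :
    gradient m x i = fderiv ℝ m x (EuclideanSpace.single i 1) := by
  rw [← inner_gradient_left, EuclideanSpace.inner_single_right]
  simp

section Gradient

variable {E : Type*} [NormedAddCommGroup E] [InnerProductSpace ℝ E] [CompleteSpace E] {m : E → ℝ}

theorem continuous_gradient (hm : ContDiff ℝ 1 m) : Continuous (gradient m) :=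
  (InnerProductSpace.toDual ℝ E).symm.continuous.comp (hm.continuous_fderiv (by simp))

theorem hasCompactSupport_gradient (hc : HasCompactSupport m) : HasCompactSupport (gradient m) :=
  (hc.fderiv (𝕜 := ℝ)).comp_left (map_zero (InnerProductSpace.toDual ℝ E).symm)

theorem norm_gradient (x : E) : ‖gradient m x‖ = ‖fderiv ℝ m x‖ :=
  (InnerProductSpace.toDual ℝ E).symm.norm_map _

end Gradient

theorem memLp_gradient {φ : E3 → ℝ} (h : ContDiff ℝ ∞ φ) (hc : HasCompactSupport φ) :
    MemLp (gradient φ) 2 (volume : Measure E3) :=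
  (continuous_gradient (h.of_le (by simp))).memLp_of_hasCompactSupport
    (hasCompactSupport_gradient hc)

theorem isWeakGradient_test {φ : E3 → ℝ} (h : ContDiff ℝ ∞ φ) (hc : HasCompactSupport φ) :
    IsWeakGradient ((memLp_test h hc).toLp φ) ((memLp_gradient h hc).toLp _) := by
  intro ψ hψ hψc i
  have hfun : ∫ x, (memLp_test h hc).toLp φ x * fderiv ℝ ψ x (EuclideanSpace.single i 1)
      = ∫ x, φ x * fderiv ℝ ψ x (EuclideanSpace.single i 1) := by
    refine integral_congr_ae ?_
    filter_upwards [(memLp_test h hc).coeFn_toLp] with x hx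
    rw [hx]
  have hgrad : ∫ x, (memLp_gradient h hc).toLp _ x i * ψ x
      = ∫ x, fderiv ℝ φ x (EuclideanSpace.single i 1) * ψ x := by
    refine integral_congr_ae ?_
    filter_upwards [(memLp_gradient h hc).coeFn_toLp] with x hx
    rw [hx, gradient_apply_coord]
  rw [hfun, hgrad]
  refine integral_mul_fderiv_eq_neg_fderiv_mul_of_integrable ?_ ?_ ?_ ?_ ?_
  · exact (memLp_test_deriv h hc _).integrable_mul (memLp_test hψ hψc)
  · exact (memLp_test h hc).integrable_mul (memLp_test_deriv hψ hψc _)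
  · exact (memLp_test h hc).integrable_mul (memLp_test hψ hψc)
  · exact fun x _ => h.differentiable (by simp) x
  · exact fun x _ => hψ.differentiable (by simp) x

/-- A test function as an element of `H¹`. -/
def ofTest {φ : E3 → ℝ} (h : ContDiff ℝ ∞ φ) (hc : HasCompactSupport φ) : H1 :=
  H1.mk _ _ (isWeakGradient_test h hc)

theorem toL2_ofTest {φ : E3 → ℝ} (h : ContDiff ℝ ∞ φ) (hc : HasCompactSupport φ) :
    toL2 (ofTest h hc) =ᵐ[volume] φ := (memLp_test h hc).coeFn_toLp

theorem grad_ofTest {φ : E3 → ℝ} (h : ContDiff ℝ ∞ φ) (hc : HasCompactSupport φ) :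
    grad (ofTest h hc) =ᵐ[volume] gradient φ := (memLp_gradient h hc).coeFn_toLp

/-- A smooth bounded function with bounded gradient: multiplication by it preserves `H¹`. -/
structure IsSmoothMultiplier (m : E3 → ℝ) : Prop where
  contDiff : ContDiff ℝ ∞ m
  memLp : MemLp m ∞ (volume : Measure E3)
  memLp_gradient : MemLp (gradient m) ∞ (volume : Measure E3)

namespace IsSmoothMultiplier

variable {m : E3 → ℝ}

theorem of_bound (hm : ContDiff ℝ ∞ m) {C C' : ℝ} (hC : ∀ x, |m x| ≤ C)
    (hC' : ∀ x, ‖gradient m x‖ ≤ C') : IsSmoothMultiplier m where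
  contDiff := hm
  memLp := memLp_top_of_bound hm.continuous.aestronglyMeasurable C (Eventually.of_forall hC)
  memLp_gradient := memLp_top_of_bound
    (continuous_gradient (hm.of_le (by simp))).aestronglyMeasurable C' (Eventually.of_forall hC')

theorem memLp_mul (hm : IsSmoothMultiplier m) (u : L2) :
    MemLp (fun x => m x * u x) 2 (volume : Measure E3) :=
  (Lp.memLp u).mul hm.memLp

theorem memLp_smul_add (hm : IsSmoothMultiplier m) (u : L2) (g : L2Vec) :
    MemLp (fun x => m x • g x + u x • gradient m x) 2 (volume : Measure E3) :=
  ((Lp.memLp g).smul hm.memLp).add (hm.memLp_gradient.smul (Lp.memLp u))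

theorem isWeakGradient_mul (hm : IsSmoothMultiplier m) {u : L2} {g : L2Vec}
    (hug : IsWeakGradient u g) :
    IsWeakGradient ((hm.memLp_mul u).toLp _) ((hm.memLp_smul_add u g).toLp _) := by
  intro φ hφ hc i
  set e : E3 := EuclideanSpace.single i 1
  have hmφ : ContDiff ℝ ∞ (fun x => m x * φ x) := hm.contDiff.mul hφ
  have hmφ_supp : HasCompactSupport (fun x => m x * φ x) := hc.mul_left
  have hdφ : ContDiff ℝ ∞ (fun x => fderiv ℝ m x e * φ x) :=
    ((hm.contDiff.fderiv_right (by simp)).clm_apply contDiff_const).mul hφ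
  have hdφ_supp : HasCompactSupport (fun x => fderiv ℝ m x e * φ x) := hc.mul_left
  have leibniz (x : E3) : fderiv ℝ (fun x => m x * φ x) x e
      = m x * fderiv ℝ φ x e + fderiv ℝ m x e * φ x := by
    rw [fderiv_fun_mul (hm.contDiff.differentiable (by simp) x) (hφ.differentiable (by simp) x)]
    simp [mul_comm]
  have hfun : ∫ x, (hm.memLp_mul u).toLp _ x * fderiv ℝ φ x e
      = ∫ x, (u x * fderiv ℝ (fun x => m x * φ x) x e - u x * (fderiv ℝ m x e * φ x)) := by
    refine integral_congr_ae ?_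
    filter_upwards [(hm.memLp_mul u).coeFn_toLp] with x hx
    rw [hx, leibniz]
    ring
  have hgrad : ∫ x, (hm.memLp_smul_add u g).toLp _ x i * φ x
      = ∫ x, (g x i * (m x * φ x) + u x * (fderiv ℝ m x e * φ x)) := by
    refine integral_congr_ae ?_
    filter_upwards [(hm.memLp_smul_add u g).coeFn_toLp] with x hx
    rw [hx, PiLp.add_apply, PiLp.smul_apply, PiLp.smul_apply, gradient_apply_coord, smul_eq_mul,
      smul_eq_mul]
    ring
  have hudφ : Integrable fun x => u x * (fderiv ℝ m x e * φ x) :=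
    (Lp.memLp u).integrable_mul (memLp_test hdφ hdφ_supp)
  rw [hfun, hgrad, integral_sub ?_ hudφ, integral_add ?_ hudφ, hug _ hmφ hmφ_supp i]
  · ring
  · exact (memLp_coord g i).integrable_mul (memLp_test hmφ hmφ_supp)
  · exact (Lp.memLp u).integrable_mul (memLp_test_deriv hmφ hmφ_supp e)

end IsSmoothMultiplier

/-- The product of a smooth multiplier and an element of `H¹`. -/
def H1.mulLeft {m : E3 → ℝ} (hm : IsSmoothMultiplier m) (v : H1) : H1 :=
  H1.mk _ _ (hm.isWeakGradient_mul (isWeakGradient_grad v))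

theorem H1.toL2_mulLeft {m : E3 → ℝ} (hm : IsSmoothMultiplier m) (v : H1) :
    toL2 (v.mulLeft hm) =ᵐ[volume] fun x => m x * toL2 v x :=
  (hm.memLp_mul (toL2 v)).coeFn_toLp

theorem H1.grad_mulLeft {m : E3 → ℝ} (hm : IsSmoothMultiplier m) (v : H1) :
    grad (v.mulLeft hm) =ᵐ[volume] fun x => m x • grad v x + toL2 v x • gradient m x :=
  (hm.memLp_smul_add (toL2 v) (grad v)).coeFn_toLp

/-! ### The form of a coefficient -/

theorem abs_mulVec_dotProduct_le {ι κ : Type*} [Fintype ι] [Fintype κ] (A : Matrix ι κ ℝ)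
    (p : EuclideanSpace ℝ κ) (q : EuclideanSpace ℝ ι) :
    |(A *ᵥ p.ofLp) ⬝ᵥ q.ofLp| ≤ (∑ i, ∑ j, |A i j|) * (‖p‖ * ‖q‖) := by
  calc |(A *ᵥ p.ofLp) ⬝ᵥ q.ofLp| = |∑ i, ∑ j, A i j * (p j * q i)| := by
        simp only [Matrix.mulVec, dotProduct, Finset.sum_mul, mul_assoc]
    _ ≤ ∑ i, ∑ j, |A i j * (p j * q i)| :=
        (Finset.abs_sum_le_sum_abs _ _).trans
          (Finset.sum_le_sum fun i _ => Finset.abs_sum_le_sum_abs _ _)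
    _ ≤ ∑ i, ∑ j, |A i j| * (‖p‖ * ‖q‖) := by
        gcongr with i _ j _
        rw [abs_mul, abs_mul]
        gcongr
        exacts [PiLp.norm_apply_le p j, PiLp.norm_apply_le q i]
    _ = (∑ i, ∑ j, |A i j|) * (‖p‖ * ‖q‖) := by simp only [Finset.sum_mul]

namespace IsCoefficient

variable {γ : E3 → Matrix (Fin 3) (Fin 3) ℝ}

theorem exists_abs_le (hγ : IsCoefficient γ) :
    ∃ M : ℝ, 0 ≤ M ∧ ∀ᵐ x : E3, ∀ p q : E3, |(γ x *ᵥ p.ofLp) ⬝ᵥ q.ofLp| ≤ M * (‖p‖ * ‖q‖) := by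
  refine ⟨∑ i, ∑ j, lpNorm (fun x => γ x i j) ∞ volume, ?_, ?_⟩
  · exact Finset.sum_nonneg fun i _ => Finset.sum_nonneg fun j _ => lpNorm_nonneg
  have hentry : ∀ᵐ x : E3, ∀ i j, |γ x i j| ≤ lpNorm (fun x => γ x i j) ∞ volume :=
    ae_all_iff.2 fun i => ae_all_iff.2 fun j => ae_le_lpNorm_exponent_top (hγ.memLp i j)
  filter_upwards [hentry] with x hx p q
  refine (abs_mulVec_dotProduct_le (γ x) p q).trans ?_
  gcongr with i _ j _
  exact hx i j

theorem integrable (hγ : IsCoefficient γ) (g h : L2Vec) :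
    Integrable fun x => (γ x *ᵥ (g x).ofLp) ⬝ᵥ (h x).ofLp := by
  obtain ⟨M, -, hM⟩ := hγ.exists_abs_le
  refine ((integrable_norm_mul_norm g h).const_mul M).mono' ?_ ?_
  · change AEStronglyMeasurable (fun x => ∑ i, (∑ j, γ x i j * g x j) * h x i) volume
    exact Finset.aestronglyMeasurable_fun_sum _ fun i _ =>
      (Finset.aestronglyMeasurable_fun_sum _ fun j _ =>
        (hγ.memLp i j).1.mul (memLp_coord g j).1).mul (memLp_coord h i).1
  · filter_upwards [hM] with x hx
    exact hx _ _

theorem exists_abs_form_le (hγ : IsCoefficient γ) :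
    ∃ M : ℝ, ∀ u φ : H1, |form γ u φ| ≤ M * ‖u‖ * ‖φ‖ := by
  obtain ⟨M, hM0, hM⟩ := hγ.exists_abs_le
  refine ⟨M, fun u φ => ?_⟩
  calc |form γ u φ| ≤ ∫ x, M * (‖grad u x‖ * ‖grad φ x‖) := by
        rw [← Real.norm_eq_abs, form]
        refine norm_integral_le_of_norm_le
          ((integrable_norm_mul_norm (grad u) (grad φ)).const_mul M) ?_
        filter_upwards [hM] with x hx
        exact hx _ _
    _ ≤ M * (‖grad u‖ * ‖grad φ‖) := by
        rw [integral_const_mul]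
        exact mul_le_mul_of_nonneg_left (integral_norm_mul_norm_le _ _) hM0
    _ ≤ M * (‖u‖ * ‖φ‖) := by gcongr <;> exact norm_grad_le _
    _ = M * ‖u‖ * ‖φ‖ := (mul_assoc _ _ _).symm

theorem form_comm (hγ : IsCoefficient γ) (u φ : H1) : form γ u φ = form γ φ u := by
  refine integral_congr_ae ?_
  filter_upwards [hγ.symm] with x hx
  rw [dotProduct_comm, Matrix.dotProduct_mulVec, ← Matrix.mulVec_transpose, hx]

theorem form_add_left (hγ : IsCoefficient γ) (u₁ u₂ φ : H1) :
    form γ (u₁ + u₂) φ = form γ u₁ φ + form γ u₂ φ := by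
  rw [form, form, form, ← integral_add (hγ.integrable _ _) (hγ.integrable _ _)]
  refine integral_congr_ae ?_
  filter_upwards [Lp.coeFn_add (grad u₁) (grad u₂)] with x hx
  rw [map_add, hx, Pi.add_apply, WithLp.ofLp_add, Matrix.mulVec_add, add_dotProduct]

end IsCoefficient

theorem form_smul_left (γ : E3 → Matrix (Fin 3) (Fin 3) ℝ) (c : ℝ) (u φ : H1) :
    form γ (c • u) φ = c * form γ u φ := by
  rw [form, form, ← integral_const_mul]
  refine integral_congr_ae ?_
  filter_upwards [Lp.coeFn_smul c (grad u)] with x hx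
  rw [map_smul, hx, Pi.smul_apply, WithLp.ofLp_smul, Matrix.mulVec_smul, smul_dotProduct,
    smul_eq_mul]

/-- The form of a coefficient as a continuous bilinear form on `H¹`. -/
def IsCoefficient.formL {γ : E3 → Matrix (Fin 3) (Fin 3) ℝ} (hγ : IsCoefficient γ) :
    H1 →L[ℝ] H1 →L[ℝ] ℝ :=
  LinearMap.mkContinuous₂
    (LinearMap.mk₂ ℝ (form γ) hγ.form_add_left (form_smul_left γ)
      (fun u φ₁ φ₂ => by simp only [hγ.form_comm u, hγ.form_add_left])
      (fun c u φ => by simp only [hγ.form_comm u, form_smul_left, smul_eq_mul]))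
    hγ.exists_abs_form_le.choose hγ.exists_abs_form_le.choose_spec

@[simp]
theorem IsCoefficient.formL_apply {γ : E3 → Matrix (Fin 3) (Fin 3) ℝ} (hγ : IsCoefficient γ)
    (u φ : H1) : hγ.formL u φ = form γ u φ := rfl

theorem dotProduct_eq_inner {ι : Type*} [Fintype ι] (p q : EuclideanSpace ℝ ι) :
    p.ofLp ⬝ᵥ q.ofLp = inner ℝ p q := by
  simp only [PiLp.inner_apply, dotProduct, RCLike.inner_apply, conj_trivial, mul_comm]

theorem form_one (u φ : H1) : form (fun _ => 1) u φ = inner ℝ (grad u) (grad φ) := by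
  simp only [form, Matrix.one_mulVec, dotProduct_eq_inner, L2.inner_def]

theorem isCoefficient_one : IsCoefficient fun _ => 1 where
  memLp _ _ := memLp_top_const _
  symm := Eventually.of_forall fun _ => Matrix.isSymm_one
  elliptic := ⟨1, one_pos, Eventually.of_forall fun _ ξ => by
    rw [one_mul, Matrix.one_mulVec, dotProduct_eq_inner, real_inner_self_eq_norm_sq]⟩

/-! ### The reduced equation -/

/-- The form `∫ γ ∇u · ∇φ + τ² u φ dx` of the operator `τ² - L_γ`. -/
def reducedForm (γ : E3 → Matrix (Fin 3) (Fin 3) ℝ) (τ : ℝ) (u φ : H1) : ℝ :=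
  form γ u φ + τ ^ 2 * inner ℝ (toL2 u) (toL2 φ)

theorem isReducedSolution_iff {γ : E3 → Matrix (Fin 3) (Fin 3) ℝ} {τ : ℝ} {f : L2} {v : H1} :
    IsReducedSolution γ τ f v ↔ ∀ φ : H1, reducedForm γ τ v φ = inner ℝ f (toL2 φ) := by
  simp only [IsReducedSolution, reducedForm, integral_mul_eq_inner]

/-- The norm `(‖∇u‖² + τ² ‖u‖²)^{1/2}`, in which the reduced equation is coercive uniformly
in `τ`. -/
def energyNorm (τ : ℝ) (u : H1) : ℝ :=
  √(‖grad u‖ ^ 2 + τ ^ 2 * ‖toL2 u‖ ^ 2)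

theorem energyNorm_nonneg (τ : ℝ) (u : H1) : 0 ≤ energyNorm τ u := Real.sqrt_nonneg _

theorem sq_energyNorm (τ : ℝ) (u : H1) :
    energyNorm τ u ^ 2 = ‖grad u‖ ^ 2 + τ ^ 2 * ‖toL2 u‖ ^ 2 :=
  Real.sq_sqrt (by positivity)

theorem mul_norm_toL2_le_energyNorm (τ : ℝ) (u : H1) : τ * ‖toL2 u‖ ≤ energyNorm τ u := by
  refine Real.le_sqrt_of_sq_le ?_
  rw [mul_pow]
  exact le_add_of_nonneg_left (sq_nonneg _)

theorem norm_le_energyNorm {τ : ℝ} (hτ : 1 ≤ τ) (u : H1) : ‖u‖ ≤ energyNorm τ u := by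
  refine Real.le_sqrt_of_sq_le ?_
  rw [norm_sq_H1, add_comm]
  gcongr
  exact le_mul_of_one_le_left (sq_nonneg _) (one_le_pow₀ hτ)

theorem abs_inner_toL2_le_energyNorm {τ : ℝ} (hτ : 0 < τ) (f : L2) (φ : H1) :
    |inner ℝ f (toL2 φ)| ≤ ‖f‖ / τ * energyNorm τ φ := by
  calc |inner ℝ f (toL2 φ)| ≤ ‖f‖ * ‖toL2 φ‖ := abs_real_inner_le_norm _ _
    _ = ‖f‖ / τ * (τ * ‖toL2 φ‖) := by field_simp
    _ ≤ ‖f‖ / τ * energyNorm τ φ := by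
        gcongr
        exact mul_norm_toL2_le_energyNorm τ φ

theorem norm_sub_sq_add_ge {E : Type*} [NormedAddCommGroup E] [InnerProductSpace ℝ E] (p q : E)
    {c : ℝ} (hc : 0 < c) :
    (1 - 1 / c) * ‖q‖ ^ 2 ≤ ‖p - q‖ ^ 2 + (c * ‖p‖ ^ 2 - ‖p‖ ^ 2) := by
  have hsquare : ‖p - q‖ ^ 2 + (c * ‖p‖ ^ 2 - ‖p‖ ^ 2)
      = (1 - 1 / c) * ‖q‖ ^ 2 + ‖c • p - q‖ ^ 2 / c := by
    rw [norm_sub_sq_real, norm_sub_sq_real, real_inner_smul_left, norm_smul, mul_pow,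
      Real.norm_eq_abs, sq_abs]
    field_simp
    ring
  rw [hsquare]
  exact le_add_of_nonneg_right (by positivity)

namespace IsCoefficient

variable {γ : E3 → Matrix (Fin 3) (Fin 3) ℝ}

theorem le_form_self (hγ : IsCoefficient γ) {c : ℝ}
    (hc : ∀ᵐ x : E3, ∀ ξ : E3, c * ‖ξ‖ ^ 2 ≤ (γ x *ᵥ ξ.ofLp) ⬝ᵥ ξ.ofLp) (u : H1) :
    c * ‖grad u‖ ^ 2 ≤ form γ u u := by
  rw [norm_sq_eq_integral, ← integral_const_mul]
  refine integral_mono_ae ((integrable_norm_sq _).const_mul _) (hγ.integrable _ _) ?_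
  filter_upwards [hc] with x hx
  exact hx _

theorem exists_mul_sq_energyNorm_le (hγ : IsCoefficient γ) :
    ∃ c : ℝ, 0 < c ∧ ∀ (τ : ℝ) (u : H1), c * energyNorm τ u ^ 2 ≤ reducedForm γ τ u u := by
  obtain ⟨c, hc, hell⟩ := hγ.elliptic
  refine ⟨min c 1, lt_min hc one_pos, fun τ u => ?_⟩
  rw [sq_energyNorm, mul_add, reducedForm, real_inner_self_eq_norm_sq]
  refine add_le_add ?_ (mul_le_of_le_one_left (by positivity) (min_le_right _ _))
  exact (mul_le_mul_of_nonneg_right (min_le_left _ _) (sq_nonneg _)).trans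
    (hγ.le_form_self hell u)

theorem reducedForm_self_nonneg (hγ : IsCoefficient γ) (τ : ℝ) (u : H1) :
    0 ≤ reducedForm γ τ u u := by
  obtain ⟨c, hc, hcoer⟩ := hγ.exists_mul_sq_energyNorm_le
  exact (by positivity : 0 ≤ c * energyNorm τ u ^ 2).trans (hcoer τ u)

theorem exists_energyNorm_le (hγ : IsCoefficient γ) :
    ∃ C : ℝ, 0 ≤ C ∧ ∀ (τ b : ℝ) (u : H1), 0 ≤ b → reducedForm γ τ u u ≤ b * energyNorm τ u →
      energyNorm τ u ≤ C * b := by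
  obtain ⟨c, hc, hcoer⟩ := hγ.exists_mul_sq_energyNorm_le
  refine ⟨c⁻¹, by positivity, fun τ b u hb hub => ?_⟩
  rcases (energyNorm_nonneg τ u).eq_or_lt with h0 | hpos
  · rw [← h0]
    positivity
  have hcb : c * energyNorm τ u ≤ b := by
    refine le_of_mul_le_mul_right ?_ hpos
    rw [mul_assoc, ← sq]
    exact (hcoer τ u).trans hub
  exact (le_inv_mul_iff₀ hc).2 hcb

/-- Completing the square at the solution `w` of `reducedForm γ τ w = G`. -/
theorem reducedForm_sub_self (hγ : IsCoefficient γ) {τ : ℝ} {w : H1} {G : H1 → ℝ}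
    (hw : ∀ φ : H1, reducedForm γ τ w φ = G φ) (v : H1) :
    reducedForm γ τ (v - w) (v - w) = reducedForm γ τ v v - 2 * G v + G w := by
  have hform : form γ (v - w) (v - w) = form γ v v - 2 * form γ w v + form γ w w := by
    simp only [← hγ.formL_apply, map_sub, sub_apply]
    rw [hγ.formL_apply v w, hγ.form_comm v w, hγ.formL_apply w v]
    ring
  rw [← hw, ← hw, reducedForm, reducedForm, reducedForm, reducedForm, hform, map_sub,
    real_inner_self_eq_norm_sq, norm_sub_sq_real, real_inner_self_eq_norm_sq,
    real_inner_self_eq_norm_sq, real_inner_comm (toL2 v) (toL2 w)]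
  ring

theorem mul_setIntegral_le_free_sub_perturbed (hγ : IsCoefficient γ) {τ : ℝ} {f : L2} {v w : H1}
    {Λ : H1Dual} (hv : ∀ φ : H1, reducedForm (fun _ => 1) τ v φ = inner ℝ f (toL2 φ))
    (hw : ∀ φ : H1, reducedForm γ τ w φ = inner ℝ f (toL2 φ) - Λ φ)
    {S : Set E3} (hS : MeasurableSet S) {k : ℝ}
    (hk : ∀ᵐ x : E3, ∀ p q : E3, S.indicator (fun _ => k) x * ‖q‖ ^ 2
      ≤ ‖p - q‖ ^ 2 + ((γ x *ᵥ p.ofLp) ⬝ᵥ p.ofLp - ‖p‖ ^ 2)) :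
    k * ∫ x in S, ‖grad v x‖ ^ 2 ≤ inner ℝ f (toL2 v) - inner ℝ f (toL2 w) - Λ w := by
  have hdiff : Integrable fun x => (γ x *ᵥ (grad w x).ofLp) ⬝ᵥ (grad w x).ofLp - ‖grad w x‖ ^ 2 :=
    (hγ.integrable _ _).sub (integrable_norm_sq _)
  have hS_le : k * ∫ x in S, ‖grad v x‖ ^ 2
      ≤ ‖grad w - grad v‖ ^ 2 + (form γ w w - ‖grad w‖ ^ 2) := by
    rw [norm_sq_eq_integral, norm_sq_eq_integral, form, ← integral_sub (hγ.integrable _ _)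
      (integrable_norm_sq _), ← integral_add (integrable_norm_sq _) hdiff]
    refine mul_setIntegral_norm_sq_le hS k _ ((integrable_norm_sq _).add hdiff) ?_
    filter_upwards [hk, Lp.coeFn_sub (grad w) (grad v)] with x hx hsub
    rw [hsub]
    exact hx _ _
  have hsq := isCoefficient_one.reducedForm_sub_self hv w
  have hww := hw w
  have hL2 : 0 ≤ τ ^ 2 * ‖toL2 (w - v)‖ ^ 2 := by positivity
  simp only [reducedForm, form_one, real_inner_self_eq_norm_sq, map_sub] at hsq hww hL2
  linarith

theorem mul_setIntegral_le_perturbed_sub_free (hγ : IsCoefficient γ) {τ : ℝ} {f : L2} {v w : H1}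
    {Λ : H1Dual} (hv : ∀ φ : H1, reducedForm (fun _ => 1) τ v φ = inner ℝ f (toL2 φ))
    (hw : ∀ φ : H1, reducedForm γ τ w φ = inner ℝ f (toL2 φ) - Λ φ)
    {S : Set E3} (hS : MeasurableSet S) {k : ℝ}
    (hk : ∀ᵐ x : E3, ∀ q : E3, S.indicator (fun _ => k) x * ‖q‖ ^ 2
      ≤ ‖q‖ ^ 2 - (γ x *ᵥ q.ofLp) ⬝ᵥ q.ofLp) :
    k * ∫ x in S, ‖grad v x‖ ^ 2
      ≤ inner ℝ f (toL2 w) - inner ℝ f (toL2 v) - Λ w + 2 * Λ v := by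
  have hS_le : k * ∫ x in S, ‖grad v x‖ ^ 2 ≤ ‖grad v‖ ^ 2 - form γ v v := by
    rw [norm_sq_eq_integral, form, ← integral_sub (integrable_norm_sq _) (hγ.integrable _ _)]
    refine mul_setIntegral_norm_sq_le hS k _ ((integrable_norm_sq _).sub (hγ.integrable _ _)) ?_
    filter_upwards [hk] with x hx
    exact hx _
  have hsq := hγ.reducedForm_sub_self hw v
  have hvv := hv v
  have hpos := hγ.reducedForm_self_nonneg τ (v - w)
  rw [hsq] at hpos
  simp only [reducedForm, form_one, real_inner_self_eq_norm_sq] at hpos hvv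
  linarith

end IsCoefficient

/-! ### Weak time derivatives -/

theorem exists_Icc_superset_of_isCompact {α : Type*} [LinearOrder α] [TopologicalSpace α]
    [OrderClosedTopology α] {K : Set α} {a b : α} (hK : IsCompact K) (hne : K.Nonempty)
    (h : K ⊆ Ioo a b) : ∃ c d : α, a < c ∧ d < b ∧ K ⊆ Icc c d := by
  obtain ⟨c, hc⟩ := hK.exists_isLeast hne
  obtain ⟨d, hd⟩ := hK.exists_isGreatest hne
  exact ⟨c, d, (h hc.1).1, (h hd.1).2, fun t ht => ⟨hc.2 ht, hd.2 ht⟩⟩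

theorem exists_primitive_of_integral_eq_zero {a b : ℝ} {ρ : ℝ → ℝ} (hρ : ContDiff ℝ ∞ ρ)
    (hc : HasCompactSupport ρ) (hs : tsupport ρ ⊆ Ioo a b) (h0 : ∫ t, ρ t = 0) :
    ∃ ψ : ℝ → ℝ, ContDiff ℝ ∞ ψ ∧ HasCompactSupport ψ ∧ tsupport ψ ⊆ Ioo a b ∧ deriv ψ = ρ := by
  obtain ⟨c, d, hac, hdb, hcd⟩ : ∃ c d, a < c ∧ d < b ∧ tsupport ρ ⊆ Icc c d := by
    rcases (tsupport ρ).eq_empty_or_nonempty with he | hne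
    · exact ⟨a + 1, b - 1, by linarith, by linarith, by simp [he]⟩
    · exact exists_Icc_superset_of_isCompact hc.isCompact hne hs
  have hρ0 (t : ℝ) (ht : t ∉ Icc c d) : ρ t = 0 :=
    image_eq_zero_of_notMem_tsupport fun h => ht (hcd h)
  have hderiv (t : ℝ) : HasDerivAt (fun t => ∫ s in a..t, ρ s) (ρ t) t :=
    intervalIntegral.integral_hasDerivAt_right (hρ.continuous.intervalIntegrable _ _)
      (hρ.continuous.stronglyMeasurableAtFilter _ _) hρ.continuous.continuousAt
  have hderiv_eq : deriv (fun t => ∫ s in a..t, ρ s) = ρ := funext fun t => (hderiv t).deriv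
  have hzero (t : ℝ) (ht : t ∉ Icc c d) : ∫ s in a..t, ρ s = 0 := by
    rcases lt_or_ge t c with htc | hct
    · refine intervalIntegral.integral_zero_ae (Eventually.of_forall fun s hs' => hρ0 s ?_)
      exact fun h => (h.1.trans (hs'.2.trans_eq rfl)).not_gt (max_lt hac htc)
    · rw [intervalIntegral.integral_eq_integral_of_support_subset, h0]
      have hdt : d < t := not_le.1 fun h => ht ⟨hct, h⟩
      exact (subset_tsupport ρ).trans (hcd.trans fun s hs' =>
        ⟨hac.trans_le hs'.1, hs'.2.trans hdt.le⟩)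
  have hsub : tsupport (fun t => ∫ s in a..t, ρ s) ⊆ Icc c d :=
    closure_minimal (fun t ht => by_contra fun h => ht (hzero t h)) isClosed_Icc
  refine ⟨fun t => ∫ s in a..t, ρ s, ?_, ?_, ?_, hderiv_eq⟩
  · rw [contDiff_infty_iff_deriv, hderiv_eq]
    exact ⟨fun t => (hderiv t).differentiableAt, hρ⟩
  · exact isCompact_Icc.of_isClosed_subset (isClosed_tsupport _) hsub
  · exact hsub.trans (Icc_subset_Ioo hac hdb)

theorem exists_contDiff_integral_eq_one {a b : ℝ} (hab : a < b) :
    ∃ ρ : ℝ → ℝ, ContDiff ℝ ∞ ρ ∧ HasCompactSupport ρ ∧ tsupport ρ ⊆ Ioo a b ∧ ∫ t, ρ t = 1 := by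
  let β : ContDiffBump ((a + b) / 2) := ⟨(b - a) / 8, (b - a) / 4, by linarith, by linarith⟩
  refine ⟨β.normed volume, β.contDiff_normed, β.hasCompactSupport_normed, ?_, β.integral_normed⟩
  rw [β.tsupport_normed_eq, Real.closedBall_eq_Icc]
  exact Icc_subset_Ioo (by change a < (a + b) / 2 - (b - a) / 4; linarith)
    (by change (a + b) / 2 + (b - a) / 4 < b; linarith)

section

variable {X : Type*} [NormedAddCommGroup X] [NormedSpace ℝ X] {T : ℝ}

theorem integrableOn_smul_Ioo {m : ℝ → ℝ} {k : ℝ → X} (hm : Continuous m)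
    (hk : IntegrableOn k (Ioo 0 T)) : IntegrableOn (fun t => m t • k t) (Ioo 0 T) :=
  IntegrableOn.continuousOn_smul_of_subset (hm.continuousOn (s := Icc 0 T)) hk isCompact_Icc
    measurableSet_Ioo Ioo_subset_Icc_self

namespace IsWeakTimeDeriv

variable {g g' k k' : ℝ → X}

theorem congr_ae (h : IsWeakTimeDeriv T g g')
    (hgk : ∀ᵐ t ∂(volume.restrict (Ioo 0 T)), k t = g t) : IsWeakTimeDeriv T k g' := by
  intro ψ hψ hψc hψs
  rw [← h ψ hψ hψc hψs]
  refine integral_congr_ae ?_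
  filter_upwards [hgk] with t ht
  rw [ht]

theorem sub (hg : IntegrableOn g (Ioo 0 T)) (hg' : IntegrableOn g' (Ioo 0 T))
    (hk : IntegrableOn k (Ioo 0 T)) (hk' : IntegrableOn k' (Ioo 0 T))
    (h₁ : IsWeakTimeDeriv T g g') (h₂ : IsWeakTimeDeriv T k k') :
    IsWeakTimeDeriv T (fun t => g t - k t) (fun t => g' t - k' t) := by
  intro ψ hψ hψc hψs
  have hψ' : Continuous (deriv ψ) := hψ.continuous_deriv (by simp)
  simp only [smul_sub]
  rw [integral_sub (integrableOn_smul_Ioo hψ' hg) (integrableOn_smul_Ioo hψ' hk),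
    integral_sub (integrableOn_smul_Ioo hψ.continuous hg')
      (integrableOn_smul_Ioo hψ.continuous hk'), h₁ ψ hψ hψc hψs, h₂ ψ hψ hψc hψs]
  abel

theorem smul {m : ℝ → ℝ} (hm : ContDiff ℝ ∞ m) (hg : IntegrableOn g (Ioo 0 T))
    (hg' : IntegrableOn g' (Ioo 0 T)) (h : IsWeakTimeDeriv T g g') :
    IsWeakTimeDeriv T (fun t => m t • g t) (fun t => m t • g' t + deriv m t • g t) := by
  intro ψ hψ hψc hψs
  have hψm : ContDiff ℝ ∞ fun t => ψ t * m t := hψ.mul hm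
  have hψm_supp : tsupport (fun t => ψ t * m t) ⊆ Ioo 0 T :=
    (closure_mono (Function.support_mul_subset_left _ _)).trans hψs
  have hleibniz (t : ℝ) : deriv (fun t => ψ t * m t) t = deriv ψ t * m t + ψ t * deriv m t :=
    deriv_fun_mul (hψ.differentiable (by simp) t) (hm.differentiable (by simp) t)
  have hweak := h _ hψm hψc.mul_right hψm_supp
  have hψ'm : IntegrableOn (fun t => (deriv ψ t * m t) • g t) (Ioo 0 T) :=
    integrableOn_smul_Ioo ((hψ.continuous_deriv (by simp)).mul hm.continuous) hg
  have hψm' : IntegrableOn (fun t => (ψ t * deriv m t) • g t) (Ioo 0 T) :=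
    integrableOn_smul_Ioo (hψ.continuous.mul (hm.continuous_deriv (by simp))) hg
  simp only [hleibniz, add_smul] at hweak
  rw [integral_add hψ'm hψm'] at hweak
  simp only [smul_add, smul_smul]
  rw [integral_add (integrableOn_smul_Ioo hψm.continuous hg') hψm', neg_add, ← hweak]
  abel

theorem clm_comp [CompleteSpace X] (h : IsWeakTimeDeriv T g g') (hg : IntegrableOn g (Ioo 0 T))
    (hg' : IntegrableOn g' (Ioo 0 T)) (l : X →L[ℝ] ℝ) :
    IsWeakTimeDeriv T (fun t => l (g t)) (fun t => l (g' t)) := by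
  intro ψ hψ hψc hψs
  have hl := congrArg l (h ψ hψ hψc hψs)
  rw [map_neg, ← l.integral_comp_comm
      (integrableOn_smul_Ioo (hψ.continuous_deriv (by simp)) hg),
    ← l.integral_comp_comm (integrableOn_smul_Ioo hψ.continuous hg')] at hl
  simpa only [map_smul] using hl

end IsWeakTimeDeriv

end

section Scalar

variable {T : ℝ}

theorem integrableOn_mul_Ioo {m k : ℝ → ℝ} (hm : Continuous m) (hk : IntegrableOn k (Ioo 0 T)) :
    IntegrableOn (fun t => m t * k t) (Ioo 0 T) :=
  integrableOn_smul_Ioo hm hk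

/-- Subtracting from a test function `g` the multiple `(∫ g) ρ` of a fixed normalised bump leaves
the derivative of a test function. -/
theorem IsWeakTimeDeriv.integral_mul_eq_of_zero {h : ℝ → ℝ} (hint : IntegrableOn h (Ioo 0 T))
    (hw : IsWeakTimeDeriv T h fun _ => 0) {g ρ : ℝ → ℝ} (hg : ContDiff ℝ ∞ g)
    (hgc : HasCompactSupport g) (hgs : tsupport g ⊆ Ioo 0 T) (hρ : ContDiff ℝ ∞ ρ)
    (hρc : HasCompactSupport ρ) (hρs : tsupport ρ ⊆ Ioo 0 T) (hρ1 : ∫ t, ρ t = 1) :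
    ∫ t in Ioo 0 T, g t * h t = (∫ t, g t) * ∫ t in Ioo 0 T, ρ t * h t := by
  have hsupp : tsupport (fun t => g t - (∫ s, g s) * ρ t) ⊆ Ioo 0 T :=
    (tsupport_sub _ _).trans (union_subset hgs
      ((closure_mono (Function.support_mul_subset_right _ _)).trans hρs))
  have hmean : ∫ t, (g t - (∫ s, g s) * ρ t) = 0 := by
    rw [integral_sub (hg.continuous.integrable_of_hasCompactSupport hgc)
      ((hρ.continuous.integrable_of_hasCompactSupport hρc).const_mul _), integral_const_mul,
      hρ1, mul_one, sub_self]
  obtain ⟨ψ, hψ, hψc, hψs, hψd⟩ := exists_primitive_of_integral_eq_zero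
    (hg.sub (contDiff_const.mul hρ)) (hgc.sub hρc.mul_left) hsupp hmean
  have hzero := hw ψ hψ hψc hψs
  simp only [hψd, smul_eq_mul, mul_zero, integral_zero, neg_zero, sub_mul, mul_assoc] at hzero
  rw [integral_sub (integrableOn_mul_Ioo hg.continuous hint)
    ((integrableOn_mul_Ioo hρ.continuous hint).const_mul _), integral_const_mul] at hzero
  exact sub_eq_zero.1 hzero

theorem IsWeakTimeDeriv.ae_eq_const_of_zero (hT : 0 < T) {h : ℝ → ℝ}
    (hint : IntegrableOn h (Ioo 0 T)) (hw : IsWeakTimeDeriv T h fun _ => 0) :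
    ∃ c : ℝ, ∀ᵐ t ∂(volume.restrict (Ioo 0 T)), h t = c := by
  obtain ⟨ρ, hρ, hρc, hρs, hρ1⟩ := exists_contDiff_integral_eq_one hT
  refine ⟨∫ t in Ioo 0 T, ρ t * h t, (ae_restrict_iff' measurableSet_Ioo).2 ?_⟩
  suffices hsub : ∀ᵐ t, t ∈ Ioo 0 T → h t - ∫ t in Ioo 0 T, ρ t * h t = 0 by
    filter_upwards [hsub] with t ht hm
    exact sub_eq_zero.1 (ht hm)
  refine isOpen_Ioo.ae_eq_zero_of_integral_contDiff_smul_eq_zero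
    (hint.sub (integrableOn_const (by simp))).locallyIntegrableOn fun g hg hgc hgs => ?_
  have hg0 (t : ℝ) (ht : t ∉ Ioo 0 T) : g t = 0 :=
    image_eq_zero_of_notMem_tsupport fun h => ht (hgs h)
  have hg_int : Integrable g := hg.continuous.integrable_of_hasCompactSupport hgc
  rw [← setIntegral_eq_integral_of_forall_compl_eq_zero fun t ht => by rw [hg0 t ht, zero_smul]]
  simp only [smul_eq_mul, mul_sub]
  rw [integral_sub (integrableOn_mul_Ioo hg.continuous hint) (hg_int.integrableOn.mul_const _),
    integral_mul_const, setIntegral_eq_integral_of_forall_compl_eq_zero hg0,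
    hw.integral_mul_eq_of_zero hint hg hgc hgs hρ hρc hρs hρ1, sub_self]

theorem isWeakTimeDeriv_intervalIntegral (hT : 0 < T) {k : ℝ → ℝ} (hk : IntegrableOn k (Ioo 0 T)) :
    IsWeakTimeDeriv T (fun t => ∫ s in (0 : ℝ)..t, k s) k := by
  intro ψ hψ _ hψs
  have hki : IntervalIntegrable k volume 0 T :=
    (intervalIntegrable_iff_integrableOn_Ioo_of_le hT.le).2 hk
  have hψ0 : ψ 0 = 0 := image_eq_zero_of_notMem_tsupport fun h => lt_irrefl _ (hψs h).1
  have hψT : ψ T = 0 := image_eq_zero_of_notMem_tsupport fun h => lt_irrefl _ (hψs h).2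
  have hparts := (hψ.of_le (by simp)).contDiffOn.absolutelyContinuousOnInterval
    |>.integral_mul_deriv_eq_deriv_mul (a := 0) (b := T)
      (hki.absolutelyContinuousOnInterval_intervalIntegral (c := 0) (by simp))
  have hderiv : ∫ t in Ioo 0 T, ψ t * deriv (fun t => ∫ s in (0 : ℝ)..t, k s) t
      = ∫ t in Ioo 0 T, ψ t * k t := by
    refine setIntegral_congr_ae measurableSet_Ioo ?_
    filter_upwards [hki.ae_hasDerivAt_integral] with t ht hm
    rw [(ht (by rw [uIcc_of_le hT.le]; exact Ioo_subset_Icc_self hm) 0 (by simp)).deriv]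
  simp only [intervalIntegral.integral_of_le hT.le, integral_Ioc_eq_integral_Ioo] at hparts
  rw [hderiv, hψ0, hψT] at hparts
  simp only [smul_eq_mul]
  linarith

theorem IsWeakTimeDeriv.integral_eq_sub (hT : 0 < T) {g g' G : ℝ → ℝ}
    (hg' : IntegrableOn g' (Ioo 0 T)) (hG : ContinuousOn G (Icc 0 T))
    (hGg : ∀ᵐ t ∂(volume.restrict (Ioo 0 T)), G t = g t) (hw : IsWeakTimeDeriv T g g') :
    ∫ t in Ioo 0 T, g' t = G T - G 0 := by
  let P : ℝ → ℝ := fun t => ∫ s in (0 : ℝ)..t, g' s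
  have hg'_int : IntervalIntegrable g' volume 0 T :=
    (intervalIntegrable_iff_integrableOn_Ioo_of_le hT.le).2 hg'
  have hP : ContinuousOn P (Icc 0 T) := by
    rw [← uIcc_of_le hT.le]
    exact (hg'_int.absolutelyContinuousOnInterval_intervalIntegral (by simp)).continuousOn
  have integrableOn {h : ℝ → ℝ} (hh : ContinuousOn h (Icc 0 T)) : IntegrableOn h (Ioo 0 T) :=
    (hh.integrableOn_compact isCompact_Icc).mono_set Ioo_subset_Icc_self
  have hzero : IsWeakTimeDeriv T (fun t => G t - P t) fun _ => 0 := by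
    simpa only [sub_self] using (hw.congr_ae hGg).sub (integrableOn hG) hg' (integrableOn hP) hg'
      (isWeakTimeDeriv_intervalIntegral hT hg')
  obtain ⟨c, hc⟩ := hzero.ae_eq_const_of_zero hT (integrableOn (hG.sub hP))
  rw [restrict_Ioo_eq_restrict_Icc] at hc
  have heq : EqOn (fun t => G t - P t) (fun _ => c) (Icc 0 T) :=
    Measure.eqOn_Icc_of_ae_eq volume hT.ne hc (hG.sub hP) continuousOn_const
  have h0 : G 0 - P 0 = c := heq ⟨le_rfl, hT.le⟩
  have hT' : G T - P T = c := heq ⟨hT.le, le_rfl⟩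
  have hP0 : P 0 = 0 := intervalIntegral.integral_same
  have hPT : P T = ∫ t in Ioo 0 T, g' t := by
    simp only [P, intervalIntegral.integral_of_le hT.le, integral_Ioc_eq_integral_Ioo]
  linarith

end Scalar

theorem IsWeakTimeDeriv.integral_exp_smul {X : Type*} [NormedAddCommGroup X] [NormedSpace ℝ X]
    [CompleteSpace X] {T : ℝ} (hT : 0 < T) (τ : ℝ) {g g' G : ℝ → X}
    (hg : IntegrableOn g (Ioo 0 T)) (hg' : IntegrableOn g' (Ioo 0 T))
    (hG : ContinuousOn G (Icc 0 T)) (hGg : ∀ᵐ t ∂(volume.restrict (Ioo 0 T)), G t = g t)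
    (hw : IsWeakTimeDeriv T g g') :
    ∫ t in Ioo 0 T, Real.exp (-τ * t) • g' t
      = Real.exp (-τ * T) • G T - G 0 + τ • ∫ t in Ioo 0 T, Real.exp (-τ * t) • g t := by
  let m : ℝ → ℝ := fun t => Real.exp (-τ * t)
  have hm : ContDiff ℝ ∞ m := by fun_prop
  have hderiv (t : ℝ) : deriv m t = -τ * m t := by
    simpa [m, mul_comm] using (((hasDerivAt_id t).const_mul (-τ)).exp).deriv
  have hmg : IntegrableOn (fun t => m t • g t) (Ioo 0 T) := integrableOn_smul_Ioo hm.continuous hg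
  have hmg' : IntegrableOn (fun t => m t • g' t) (Ioo 0 T) :=
    integrableOn_smul_Ioo hm.continuous hg'
  have hsum : ∫ t in Ioo 0 T, (m t • g' t + deriv m t • g t)
      = (∫ t in Ioo 0 T, m t • g' t) - τ • ∫ t in Ioo 0 T, m t • g t := by
    simp only [hderiv, neg_mul, neg_smul, mul_smul, ← sub_eq_add_neg]
    rw [integral_sub (hmg') (g := fun t => τ • m t • g t) (hmg.smul τ), integral_smul]
  have hsum_int : IntegrableOn (fun t => m t • g' t + deriv m t • g t) (Ioo 0 T) :=
    hmg'.add (integrableOn_smul_Ioo (hm.continuous_deriv (by simp)) hg)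
  suffices h : ∫ t in Ioo 0 T, (m t • g' t + deriv m t • g t) = m T • G T - G 0 by
    rw [← h, hsum, sub_add_cancel]
  refine (SeparatingDual.eq_iff_forall_dual_eq (R := ℝ)).2 fun l => ?_
  have hl := ((hw.smul hm hg hg').clm_comp hmg hsum_int l).integral_eq_sub hT
    (l.integrable_comp hsum_int)
    (G := fun t => l (m t • G t))
    (l.continuous.comp_continuousOn (hm.continuous.continuousOn.smul hG))
    (hGg.mono fun t ht => by rw [ht])
  rw [← l.integral_comp_comm hsum_int, hl, map_sub]
  simp [m]

/-! ### The truncated Laplace transform -/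

theorem setIntegral_clm_apply_smul {X Y : Type*} [NormedAddCommGroup X] [NormedSpace ℝ X]
    [CompleteSpace X] [NormedAddCommGroup Y] [NormedSpace ℝ Y] [CompleteSpace Y] (l : X →L[ℝ] Y)
    {T : ℝ} {m : ℝ → ℝ} (hm : Continuous m) {g : ℝ → X} (hg : IntegrableOn g (Ioo 0 T)) :
    ∫ t in Ioo 0 T, m t • l (g t) = l (∫ t in Ioo 0 T, m t • g t) := by
  rw [← l.integral_comp_comm (integrableOn_smul_Ioo hm hg)]
  simp only [map_smul]

theorem toL2_integral_exp_smul {T : ℝ} (hT : 0 < T) (τ : ℝ) {u : ℝ → H1}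
    (hu : IntegrableOn u (Ioo 0 T)) :
    toL2 (∫ t in Ioo 0 T, Real.exp (-τ * t) • u t) = truncLaplace T u τ := by
  rw [truncLaplace, intervalIntegral.integral_of_le hT.le, integral_Ioc_eq_integral_Ioo,
    ← setIntegral_clm_apply_smul toL2 (by fun_prop) hu]

/-- `toH1Dual` as a continuous linear map. -/
def toH1DualL : L2 →L[ℝ] H1Dual :=
  ((ContinuousLinearMap.compL ℝ H1 L2 ℝ).flip toL2).comp (innerSL ℝ)

theorem toH1DualL_apply (g : L2) : toH1DualL g = toH1Dual g := rfl

theorem IsCoefficient.form_integral_exp_smul {γ : E3 → Matrix (Fin 3) (Fin 3) ℝ}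
    (hγ : IsCoefficient γ) {T : ℝ} (τ : ℝ) {u : ℝ → H1} {utt : ℝ → H1Dual}
    (hu : IntegrableOn u (Ioo 0 T)) (hutt : IntegrableOn utt (Ioo 0 T))
    (heq : ∀ᵐ t ∂(volume.restrict (Ioo 0 T)), ∀ φ : H1, utt t φ + form γ (u t) φ = 0) (φ : H1) :
    form γ (∫ t in Ioo 0 T, Real.exp (-τ * t) • u t) φ
      = -(∫ t in Ioo 0 T, Real.exp (-τ * t) • utt t) φ := by
  have hexp : Continuous fun t => Real.exp (-τ * t) := by fun_prop
  have hform := setIntegral_clm_apply_smul (hγ.formL.flip φ) hexp hu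
  have happly := setIntegral_clm_apply_smul (ContinuousLinearMap.apply ℝ ℝ φ) hexp hutt
  simp only [ContinuousLinearMap.flip_apply, hγ.formL_apply,
    ContinuousLinearMap.apply_apply] at hform happly
  rw [← hform, ← happly, ← integral_neg]
  refine integral_congr_ae ?_
  filter_upwards [heq] with t ht
  rw [eq_neg_of_add_eq_zero_right (ht φ), smul_neg]

namespace IsWeakWaveSolution

variable {γ : E3 → Matrix (Fin 3) (Fin 3) ℝ} {T : ℝ} {f : L2} {u : ℝ → H1}

/-- Integrating by parts twice in time: `Λ` and `a` are `∂_t u(T)` and `u(T)`. -/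
theorem exists_reducedForm_eq (hu : IsWeakWaveSolution γ T f u) (hγ : IsCoefficient γ)
    (hT : 0 < T) :
    ∃ (Λ : H1Dual) (a : L2), ∀ τ : ℝ, ∃ w : H1, toL2 w = truncLaplace T u τ ∧
      ∀ φ : H1, reducedForm γ τ w φ
        = inner ℝ f (toL2 φ) - Real.exp (-τ * T) * (Λ φ + τ * toH1Dual a φ) := by
  obtain ⟨ut, utt, hu_mem, hut_mem, hutt_mem, hut, hutt, heq, ⟨U, hU, hU_ae, hU0⟩,
    ⟨V, hV, hV_ae, hV0⟩⟩ := hu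
  have hu_int : IntegrableOn u (Ioo 0 T) := hu_mem.integrable one_le_two
  have hut_int : IntegrableOn ut (Ioo 0 T) := hut_mem.integrable one_le_two
  have hutt_int : IntegrableOn utt (Ioo 0 T) := hutt_mem.integrable one_le_two
  refine ⟨V T, U T, fun τ => ⟨_, toL2_integral_exp_smul hT τ hu_int, fun φ => ?_⟩⟩
  have hexp : Continuous fun t => Real.exp (-τ * t) := by fun_prop
  have hparts_u := hut.integral_exp_smul hT τ (toL2.integrable_comp hu_int) hut_int hU hU_ae
  have hparts_ut := hutt.integral_exp_smul hT τ (toH1DualL.integrable_comp hut_int) hutt_int hV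
    hV_ae
  have hdual := setIntegral_clm_apply_smul toH1DualL hexp hut_int
  rw [setIntegral_clm_apply_smul toL2 hexp hu_int, hU0, sub_zero] at hparts_u
  rw [hdual, hparts_u, hV0] at hparts_ut
  rw [reducedForm, hγ.form_integral_exp_smul τ hu_int hutt_int heq, hparts_ut]
  simp only [add_apply, sub_apply, smul_apply, toH1DualL_apply, toH1Dual_apply, inner_add_left,
    real_inner_smul_left, smul_eq_mul]
  ring

end IsWeakWaveSolution

theorem indicatorFn_eq_inner_sub {T : ℝ} {f : L2} {u v : ℝ → H1} {τ : ℝ} {w : H1}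
    (hw : toL2 w = truncLaplace T u τ) :
    indicatorFn T f u v τ = inner ℝ f (toL2 w) - inner ℝ f (toL2 (v τ)) := by
  rw [indicatorFn, ← hw, ← inner_sub_right, ← integral_mul_eq_inner]
  refine integral_congr_ae ?_
  filter_upwards [Lp.coeFn_sub (toL2 w) (toL2 (v τ))] with x hx
  rw [hx, Pi.sub_apply]

theorem exp_neg_mul_le {τ T : ℝ} (hτ : 0 < τ) (hT : 0 < T) : Real.exp (-τ * T) ≤ 1 / T / τ := by
  rw [neg_mul, Real.exp_neg, div_div, one_div]
  refine inv_anti₀ (by positivity) ?_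
  linarith [Real.add_one_le_exp (τ * T)]

theorem abs_apply_add_mul_toH1Dual_le (Λ : H1Dual) (a : L2) {τ : ℝ} (hτ : 1 ≤ τ) (φ : H1) :
    |Λ φ + τ * toH1Dual a φ| ≤ (‖Λ‖ + ‖a‖) * energyNorm τ φ := by
  have hτ0 : 0 < τ := one_pos.trans_le hτ
  have hΛ : |Λ φ| ≤ ‖Λ‖ * energyNorm τ φ :=
    (Λ.le_opNorm φ).trans (by gcongr; exact norm_le_energyNorm hτ φ)
  have ha : |τ * toH1Dual a φ| ≤ ‖a‖ * energyNorm τ φ := by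
    rw [abs_mul, abs_of_pos hτ0]
    calc τ * |toH1Dual a φ| ≤ τ * (‖a‖ / τ * energyNorm τ φ) := by
          gcongr
          exact abs_inner_toL2_le_energyNorm hτ0 a φ
      _ = ‖a‖ * energyNorm τ φ := by field_simp
  calc |Λ φ + τ * toH1Dual a φ| ≤ |Λ φ| + |τ * toH1Dual a φ| := abs_add_le _ _
    _ ≤ (‖Λ‖ + ‖a‖) * energyNorm τ φ := by rw [add_mul]; exact add_le_add hΛ ha

theorem IsCoefficient.exists_energyNorm_le_div {γ : E3 → Matrix (Fin 3) (Fin 3) ℝ}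
    (hγ : IsCoefficient γ) {T : ℝ} (hT : 0 < T) (f : L2) (Λ : H1Dual) (a : L2) :
    ∃ C : ℝ, ∀ τ : ℝ, 1 ≤ τ → ∀ w : H1, (∀ φ : H1, reducedForm γ τ w φ
        = inner ℝ f (toL2 φ) - Real.exp (-τ * T) * (Λ φ + τ * toH1Dual a φ)) →
      energyNorm τ w ≤ C / τ := by
  obtain ⟨C, -, hC⟩ := hγ.exists_energyNorm_le
  refine ⟨C * (‖f‖ + (‖Λ‖ + ‖a‖) / T), fun τ hτ w hw => ?_⟩
  have hτ0 : 0 < τ := one_pos.trans_le hτ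
  have hf := abs_inner_toL2_le_energyNorm hτ0 f w
  have hremainder : Real.exp (-τ * T) * |Λ w + τ * toH1Dual a w|
      ≤ 1 / T / τ * ((‖Λ‖ + ‖a‖) * energyNorm τ w) := by
    gcongr
    · exact exp_neg_mul_le hτ0 hT
    · exact abs_apply_add_mul_toH1Dual_le Λ a hτ w
  have hself : reducedForm γ τ w w ≤ (‖f‖ + (‖Λ‖ + ‖a‖) / T) / τ * energyNorm τ w := by
    rw [hw]
    calc inner ℝ f (toL2 w) - Real.exp (-τ * T) * (Λ w + τ * toH1Dual a w)
        ≤ |inner ℝ f (toL2 w)| + Real.exp (-τ * T) * |Λ w + τ * toH1Dual a w| := by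
          have hneg := mul_le_mul_of_nonneg_left (neg_abs_le (Λ w + τ * toH1Dual a w))
            (Real.exp_pos (-τ * T)).le
          linarith [le_abs_self (inner ℝ f (toL2 w))]
      _ ≤ ‖f‖ / τ * energyNorm τ w + 1 / T / τ * ((‖Λ‖ + ‖a‖) * energyNorm τ w) :=
          add_le_add hf hremainder
      _ = (‖f‖ + (‖Λ‖ + ‖a‖) / T) / τ * energyNorm τ w := by ring
  rw [mul_div_assoc]
  exact hC τ _ w (by positivity) hself

namespace IsWeakWaveSolution

variable {γ : E3 → Matrix (Fin 3) (Fin 3) ℝ} {T : ℝ} {f : L2} {u v : ℝ → H1}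

theorem exists_perturbation (hu : IsWeakWaveSolution γ T f u) (hγ : IsCoefficient γ) (hT : 0 < T)
    (hv : ∀ τ : ℝ, 1 ≤ τ → IsReducedSolution (fun _ => 1) τ f (v τ)) :
    ∃ K : ℝ, ∀ τ : ℝ, 1 ≤ τ → ∃ (w : H1) (Λ : H1Dual),
      indicatorFn T f u v τ = inner ℝ f (toL2 w) - inner ℝ f (toL2 (v τ)) ∧
      (∀ φ : H1, reducedForm γ τ w φ = inner ℝ f (toL2 φ) - Λ φ) ∧
      |Λ w| ≤ K / τ * Real.exp (-τ * T) ∧ |Λ (v τ)| ≤ K / τ * Real.exp (-τ * T) := by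
  obtain ⟨Λ, a, hΛ⟩ := hu.exists_reducedForm_eq hγ hT
  obtain ⟨C₁, hC₁⟩ := hγ.exists_energyNorm_le_div hT f Λ a
  obtain ⟨C₀, hC₀⟩ := isCoefficient_one.exists_energyNorm_le_div hT f 0 0
  refine ⟨(‖Λ‖ + ‖a‖) * max C₁ C₀, fun τ hτ => ?_⟩
  obtain ⟨w, hw, hwφ⟩ := hΛ τ
  have hτ0 : 0 < τ := one_pos.trans_le hτ
  have hbound (φ : H1) (hφ : energyNorm τ φ ≤ max C₁ C₀ / τ) :
      |Real.exp (-τ * T) * (Λ φ + τ * toH1Dual a φ)|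
        ≤ (‖Λ‖ + ‖a‖) * max C₁ C₀ / τ * Real.exp (-τ * T) := by
    rw [abs_mul, Real.abs_exp, mul_comm, mul_div_assoc]
    gcongr
    exact (abs_apply_add_mul_toH1Dual_le Λ a hτ φ).trans (by gcongr)
  have hv_norm : energyNorm τ (v τ) ≤ C₀ / τ := by
    refine hC₀ τ hτ (v τ) fun φ => ?_
    rw [isReducedSolution_iff.1 (hv τ hτ)]
    simp [toH1Dual_apply]
  refine ⟨w, Real.exp (-τ * T) • (Λ + τ • toH1Dual a), indicatorFn_eq_inner_sub hw, hwφ,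
    hbound w ((hC₁ τ hτ w hwφ).trans ?_), hbound (v τ) (hv_norm.trans ?_)⟩
  · gcongr
    exact le_max_left _ _
  · gcongr
    exact le_max_right _ _

theorem exists_mul_setIntegral_le (hu : IsWeakWaveSolution γ T f u) (hγ : IsCoefficient γ)
    (hT : 0 < T) (hv : ∀ τ : ℝ, 1 ≤ τ → IsReducedSolution (fun _ => 1) τ f (v τ)) :
    ∃ K : ℝ, ∀ (S : Set E3) (k : ℝ), MeasurableSet S →
      ((∀ᵐ x : E3, ∀ p q : E3, S.indicator (fun _ => k) x * ‖q‖ ^ 2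
          ≤ ‖p - q‖ ^ 2 + ((γ x *ᵥ p.ofLp) ⬝ᵥ p.ofLp - ‖p‖ ^ 2)) → ∀ τ : ℝ, 1 ≤ τ →
        k * ∫ x in S, ‖grad (v τ) x‖ ^ 2
          ≤ -indicatorFn T f u v τ + K / τ * Real.exp (-τ * T)) ∧
      ((∀ᵐ x : E3, ∀ q : E3, S.indicator (fun _ => k) x * ‖q‖ ^ 2
          ≤ ‖q‖ ^ 2 - (γ x *ᵥ q.ofLp) ⬝ᵥ q.ofLp) → ∀ τ : ℝ, 1 ≤ τ →
        k * ∫ x in S, ‖grad (v τ) x‖ ^ 2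
          ≤ indicatorFn T f u v τ + K / τ * Real.exp (-τ * T)) := by
  obtain ⟨K, hK⟩ := hu.exists_perturbation hγ hT hv
  refine ⟨3 * K, fun S k hS => ⟨fun hk τ hτ => ?_, fun hk τ hτ => ?_⟩⟩ <;>
    obtain ⟨w, Λ, hI, hw, hΛw, hΛv⟩ := hK τ hτ <;>
    rw [hI, mul_div_assoc, mul_assoc]
  · have henergy := hγ.mul_setIntegral_le_free_sub_perturbed (isReducedSolution_iff.1 (hv τ hτ)) hw
      hS hk
    linarith [neg_le_abs (Λ w), abs_nonneg (Λ w)]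
  · have henergy := hγ.mul_setIntegral_le_perturbed_sub_free (isReducedSolution_iff.1 (hv τ hτ)) hw
      hS hk
    linarith [neg_le_abs (Λ w), le_abs_self (Λ (v τ))]

end IsWeakWaveSolution

/-! ### Weighted energy estimates -/

theorem mul_norm_sq_le_inner_add {E : Type*} [NormedAddCommGroup E] [InnerProductSpace ℝ E]
    {τ θ m : ℝ} (hθ : 0 ≤ θ) (hθ1 : θ ≤ 1) (hm : 0 ≤ m) {p g : E} {s : ℝ}
    (hg : ‖g‖ ≤ 2 * τ * θ * m) :
    (1 - θ) * (m * ‖p‖ ^ 2) ≤ inner ℝ p (m • p + s • g) + τ ^ 2 * (s * (m * s)) := by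
  have hcross : -(|s| * (‖p‖ * (2 * τ * θ * m))) ≤ s * inner ℝ p g := by
    refine neg_le_of_abs_le ?_
    rw [abs_mul]
    gcongr
    exact (abs_real_inner_le_norm _ _).trans (by gcongr)
  have hsquare : (1 - θ) * (m * ‖p‖ ^ 2) ≤ m * ‖p‖ ^ 2 - |s| * (‖p‖ * (2 * τ * θ * m))
      + τ ^ 2 * (m * |s| ^ 2) := by
    have h₁ : 0 ≤ θ * m * (‖p‖ - τ * |s|) ^ 2 := by positivity
    have h₂ : 0 ≤ (1 - θ) * (m * (τ * |s|) ^ 2) :=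
      mul_nonneg (sub_nonneg.2 hθ1) (by positivity)
    linarith
  rw [inner_add_right, inner_smul_right, inner_smul_right, real_inner_self_eq_norm_sq]
  rw [sq_abs] at hsquare
  linarith

theorem inner_toL2_mulLeft_le {m : E3 → ℝ} (hm : IsSmoothMultiplier m) {f : L2} {μ : ℝ}
    (hμ : 0 ≤ μ) (hf : ∀ᵐ x : E3, f x = 0 ∨ |m x| ≤ μ) (v : H1) :
    inner ℝ f (toL2 (v.mulLeft hm)) ≤ μ * (‖f‖ * ‖toL2 v‖) := by
  have hpointwise : inner ℝ f (toL2 (v.mulLeft hm)) ≤ ∫ x, μ * (‖f x‖ * ‖toL2 v x‖) := by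
    rw [← integral_mul_eq_inner]
    refine integral_mono_ae ((Lp.memLp f).integrable_mul (Lp.memLp (toL2 (v.mulLeft hm))))
      ((integrable_norm_mul_norm f (toL2 v)).const_mul μ) ?_
    filter_upwards [hf, H1.toL2_mulLeft hm v] with x hfx hx
    rw [hx]
    rcases hfx with h0 | hmx
    · simp [h0]
    · calc f x * (m x * toL2 v x) ≤ |f x * (m x * toL2 v x)| := le_abs_self _
        _ = |m x| * (‖f x‖ * ‖toL2 v x‖) := by
            rw [abs_mul, abs_mul, Real.norm_eq_abs, Real.norm_eq_abs]
            ring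
        _ ≤ μ * (‖f x‖ * ‖toL2 v x‖) := by gcongr
  rw [integral_const_mul] at hpointwise
  exact hpointwise.trans (by gcongr; exact integral_norm_mul_norm_le f (toL2 v))

theorem integrable_mul_norm_sq {m : E3 → ℝ} (hm : IsSmoothMultiplier m) (g : L2Vec) :
    Integrable fun x => m x * ‖g x‖ ^ 2 :=
  (integrable_norm_sq g).mul_of_top_right hm.memLp

namespace IsReducedSolution

variable {τ : ℝ} {f : L2} {v : H1}

/-- Agmon's estimate: the reduced equation is tested with `m v`, where the logarithmic gradient of
the weight `m` is at most `2 τ θ`. -/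
theorem mul_integral_weight_le (hv : IsReducedSolution (fun _ => 1) τ f v)
    {m : E3 → ℝ} (hm : IsSmoothMultiplier m) (hm0 : ∀ x, 0 ≤ m x) {θ : ℝ} (hθ : 0 ≤ θ)
    (hθ1 : θ ≤ 1) (hgrad : ∀ x, ‖gradient m x‖ ≤ 2 * τ * θ * m x) :
    (1 - θ) * ∫ x, m x * ‖grad v x‖ ^ 2 ≤ inner ℝ f (toL2 (v.mulLeft hm)) := by
  have hL2 : Integrable fun x => toL2 v x * toL2 (v.mulLeft hm) x :=
    (Lp.memLp (toL2 v)).integrable_mul (Lp.memLp (toL2 (v.mulLeft hm)))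
  have hgrad_int := L2.integrable_inner (𝕜 := ℝ) (grad v) (grad (v.mulLeft hm))
  rw [← isReducedSolution_iff.1 hv, reducedForm, form_one, L2.inner_def, ← integral_mul_eq_inner,
    ← integral_const_mul, ← integral_const_mul, ← integral_add hgrad_int (hL2.const_mul _)]
  refine integral_mono_ae ((integrable_mul_norm_sq hm _).const_mul _)
    (hgrad_int.add (hL2.const_mul _)) ?_
  filter_upwards [H1.toL2_mulLeft hm v, H1.grad_mulLeft hm v] with x hx hgx
  rw [hx, hgx]
  exact mul_norm_sq_le_inner_add hθ hθ1 (hm0 x) (hgrad x)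

theorem norm_toL2_le {γ : E3 → Matrix (Fin 3) (Fin 3) ℝ} (hv : IsReducedSolution γ τ f v)
    (hγ : IsCoefficient γ) (hτ : 1 ≤ τ) : ‖toL2 v‖ ≤ ‖f‖ := by
  obtain ⟨c, hc, hell⟩ := hγ.elliptic
  have hform : 0 ≤ form γ v v := le_trans (by positivity) (hγ.le_form_self hell v)
  have hself := isReducedSolution_iff.1 hv v
  rw [reducedForm, real_inner_self_eq_norm_sq] at hself
  have hτ2 : ‖toL2 v‖ ^ 2 ≤ τ ^ 2 * ‖toL2 v‖ ^ 2 :=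
    le_mul_of_one_le_left (sq_nonneg _) (one_le_pow₀ hτ)
  have hle : ‖toL2 v‖ * ‖toL2 v‖ ≤ ‖f‖ * ‖toL2 v‖ := by
    linarith [real_inner_le_norm f (toL2 v)]
  rcases (norm_nonneg (toL2 v)).eq_or_lt with h0 | hpos
  · rw [← h0]
    exact norm_nonneg f
  · exact le_of_mul_le_mul_right hle hpos

end IsReducedSolution

section SmoothDist

variable {E : Type*} [NormedAddCommGroup E]

/-- The regularisation `√(|x - x₀|² + ε²)` of the distance from a point. -/
def smoothDist (x₀ : E) (ε : ℝ) (x : E) : ℝ := √(‖x - x₀‖ ^ 2 + ε ^ 2)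

theorem dist_le_smoothDist (x₀ : E) (ε : ℝ) (x : E) : dist x x₀ ≤ smoothDist x₀ ε x := by
  rw [dist_eq_norm]
  exact Real.le_sqrt_of_sq_le (le_add_of_nonneg_right (sq_nonneg ε))

theorem smoothDist_le_dist_add (x₀ : E) {ε : ℝ} (hε : 0 ≤ ε) (x : E) :
    smoothDist x₀ ε x ≤ dist x x₀ + ε := by
  refine Real.sqrt_le_iff.2 ⟨by positivity, ?_⟩
  rw [dist_eq_norm, add_sq]
  linarith [mul_nonneg (norm_nonneg (x - x₀)) hε]

theorem lipschitzWith_smoothDist (x₀ : E) (ε : ℝ) : LipschitzWith 1 (smoothDist x₀ ε) := by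
  refine LipschitzWith.of_le_add fun x y => ?_
  have htriangle : ‖x - x₀‖ ≤ dist y x₀ + dist x y := by
    rw [← dist_eq_norm, add_comm]
    exact dist_triangle _ _ _
  have hsq : smoothDist x₀ ε y ^ 2 = dist y x₀ ^ 2 + ε ^ 2 := by
    rw [smoothDist, Real.sq_sqrt (by positivity), dist_eq_norm]
  refine Real.sqrt_le_iff.2 ⟨add_nonneg (Real.sqrt_nonneg _) dist_nonneg, ?_⟩
  calc ‖x - x₀‖ ^ 2 + ε ^ 2 ≤ (dist y x₀ + dist x y) ^ 2 + ε ^ 2 := by gcongr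
    _ = smoothDist x₀ ε y ^ 2 + 2 * (dist y x₀ * dist x y) + dist x y ^ 2 := by rw [hsq]; ring
    _ ≤ smoothDist x₀ ε y ^ 2 + 2 * (smoothDist x₀ ε y * dist x y) + dist x y ^ 2 := by
        gcongr
        exact dist_le_smoothDist x₀ ε y
    _ = (smoothDist x₀ ε y + dist x y) ^ 2 := by ring

variable [InnerProductSpace ℝ E]

theorem contDiff_smoothDist (x₀ : E) {ε : ℝ} (hε : 0 < ε) : ContDiff ℝ ∞ (smoothDist x₀ ε) := by
  refine ContDiff.sqrt ?_ fun x => by positivity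
  exact ((contDiff_id.sub contDiff_const).norm_sq ℝ).add contDiff_const

theorem norm_gradient_exp_smoothDist_le [CompleteSpace E] (x₀ : E) {ε κ : ℝ} (hε : 0 < ε)
    (hκ : 0 ≤ κ) (x : E) :
    ‖gradient (fun x => Real.exp (-κ * smoothDist x₀ ε x)) x‖
      ≤ κ * Real.exp (-κ * smoothDist x₀ ε x) := by
  have hderiv := ((((contDiff_smoothDist x₀ hε).differentiable (by simp) x).hasFDerivAt).const_mul
    (-κ)).exp
  have hlip : ‖fderiv ℝ (smoothDist x₀ ε) x‖ ≤ 1 := by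
    simpa using norm_fderiv_le_of_lipschitz ℝ (lipschitzWith_smoothDist x₀ ε) (x₀ := x)
  rw [norm_gradient, hderiv.fderiv, norm_smul, norm_smul, Real.norm_eq_abs, Real.norm_eq_abs,
    abs_neg, abs_of_nonneg hκ, Real.abs_exp, mul_comm κ (Real.exp _)]
  gcongr
  exact mul_le_of_le_one_right hκ hlip

end SmoothDist

theorem isSmoothMultiplier_exp_smoothDist (x₀ : E3) {ε κ : ℝ} (hε : 0 < ε) (hκ : 0 ≤ κ) :
    IsSmoothMultiplier fun x => Real.exp (-κ * smoothDist x₀ ε x) := by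
  have hle (x : E3) : Real.exp (-κ * smoothDist x₀ ε x) ≤ 1 :=
    Real.exp_le_one_iff.2 (mul_nonpos_of_nonpos_of_nonneg (neg_nonpos.2 hκ) (Real.sqrt_nonneg _))
  refine .of_bound (contDiff_const.mul (contDiff_smoothDist x₀ hε)).exp (C := 1) (C' := κ)
    (fun x => (Real.abs_exp _).trans_le (hle x)) fun x => ?_
  exact (norm_gradient_exp_smoothDist_le x₀ hε hκ x).trans (mul_le_of_le_one_right hκ (hle x))

theorem exp_mul_setIntegral_ball_le (x₀ : E3) {ε κ : ℝ} (hε : 0 < ε) (hκ : 0 ≤ κ) (g : L2Vec) :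
    Real.exp (-κ * (2 * ε)) * ∫ x in Metric.ball x₀ ε, ‖g x‖ ^ 2
      ≤ ∫ x, Real.exp (-κ * smoothDist x₀ ε x) * ‖g x‖ ^ 2 := by
  have hweight (x : E3) : (Metric.ball x₀ ε).indicator (fun _ => Real.exp (-κ * (2 * ε))) x
      ≤ Real.exp (-κ * smoothDist x₀ ε x) := by
    refine indicator_apply_le' (fun hx => Real.exp_le_exp.2 ?_) fun _ => (Real.exp_pos _).le
    have hdist : smoothDist x₀ ε x ≤ 2 * ε := by
      linarith [smoothDist_le_dist_add x₀ hε.le x, Metric.mem_ball.1 hx]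
    exact mul_le_mul_of_nonpos_left hdist (neg_nonpos.2 hκ)
  exact mul_setIntegral_norm_sq_le measurableSet_ball _ g
    (integrable_mul_norm_sq (isSmoothMultiplier_exp_smoothDist x₀ hε hκ) g)
    (Eventually.of_forall fun x => mul_le_mul_of_nonneg_right (hweight x) (sq_nonneg _))

theorem IsReducedSolution.mul_setIntegral_ball_le {τ : ℝ} {f : L2} {v : H1}
    (hv : IsReducedSolution (fun _ => 1) τ f v) (hτ : 1 ≤ τ) {x₀ : E3} {d θ ε : ℝ} (hθ : 0 ≤ θ)
    (hθ1 : θ ≤ 1) (hε : 0 < ε) (hf : ∀ᵐ x : E3, f x = 0 ∨ d ≤ dist x x₀) :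
    (1 - θ) * ∫ x in Metric.ball x₀ ε, ‖grad v x‖ ^ 2
      ≤ ‖f‖ ^ 2 * Real.exp (-τ * (2 * θ * (d - 2 * ε))) := by
  have hκ : 0 ≤ 2 * τ * θ := mul_nonneg (by linarith) hθ
  set κ := 2 * τ * θ
  have hm := isSmoothMultiplier_exp_smoothDist x₀ hε hκ
  have hsource : ∀ᵐ x : E3, f x = 0 ∨ |Real.exp (-κ * smoothDist x₀ ε x)| ≤ Real.exp (-κ * d) := by
    filter_upwards [hf] with x hx
    refine hx.imp_right fun hdx => ?_
    rw [Real.abs_exp, Real.exp_le_exp]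
    exact mul_le_mul_of_nonpos_left (hdx.trans (dist_le_smoothDist x₀ ε x)) (neg_nonpos.2 hκ)
  have hmain : Real.exp (-κ * (2 * ε)) * ((1 - θ) * ∫ x in Metric.ball x₀ ε, ‖grad v x‖ ^ 2)
      ≤ Real.exp (-κ * d) * ‖f‖ ^ 2 := by
    calc Real.exp (-κ * (2 * ε)) * ((1 - θ) * ∫ x in Metric.ball x₀ ε, ‖grad v x‖ ^ 2)
        ≤ (1 - θ) * ∫ x, Real.exp (-κ * smoothDist x₀ ε x) * ‖grad v x‖ ^ 2 := by
          rw [mul_left_comm]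
          exact mul_le_mul_of_nonneg_left (exp_mul_setIntegral_ball_le x₀ hε hκ _)
            (sub_nonneg.2 hθ1)
      _ ≤ inner ℝ f (toL2 (v.mulLeft hm)) :=
          hv.mul_integral_weight_le hm (fun x => (Real.exp_pos _).le) hθ hθ1
            (norm_gradient_exp_smoothDist_le x₀ hε hκ)
      _ ≤ Real.exp (-κ * d) * (‖f‖ * ‖toL2 v‖) :=
          inner_toL2_mulLeft_le hm (Real.exp_pos _).le hsource v
      _ ≤ Real.exp (-κ * d) * ‖f‖ ^ 2 := by
          rw [sq]
          gcongr
          exact hv.norm_toL2_le isCoefficient_one hτ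
  refine le_of_mul_le_mul_left (hmain.trans_eq ?_) (Real.exp_pos (-κ * (2 * ε)))
  rw [mul_left_comm, ← Real.exp_add, mul_comm]
  congr 2
  ring

theorem setIntegral_le_card_mul {α ι : Type*} [MeasurableSpace α] {μ : Measure α} {S : Set α}
    {t : Finset ι} {U : ι → Set α} (hcov : S ⊆ ⋃ i ∈ t, U i) {g : α → ℝ} (hg : Integrable g μ)
    (hg0 : ∀ x, 0 ≤ g x) {M : ℝ} (hM : ∀ i ∈ t, ∫ x in U i, g x ∂μ ≤ M) :
    ∫ x in S, g x ∂μ ≤ t.card * M := by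
  have hmeas : μ.restrict S ≤ ∑ i ∈ t, μ.restrict (U i) := by
    refine (Measure.restrict_mono hcov le_rfl).trans ?_
    rw [← Measure.sum_coe_finset]
    exact Measure.restrict_biUnion_le t.countable_toSet
  calc ∫ x in S, g x ∂μ ≤ ∫ x, g x ∂(∑ i ∈ t, μ.restrict (U i)) :=
        integral_mono_measure hmeas (Eventually.of_forall hg0)
          (integrable_finsetSum_measure.2 fun i _ => hg.integrableOn)
    _ = ∑ i ∈ t, ∫ x in U i, g x ∂μ := integral_finsetSum_measure fun i _ => hg.integrableOn
    _ ≤ t.card * M := by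
        rw [← nsmul_eq_mul]
        exact Finset.sum_le_card_nsmul t _ M hM

theorem exists_setIntegral_norm_sq_grad_le {f : L2} {S : Set E3} (hS : IsCompact S) {d β : ℝ}
    (hβ : β < 2 * d) (hf : ∀ x₀ ∈ S, ∀ᵐ x : E3, f x = 0 ∨ d ≤ dist x x₀) :
    ∃ C : ℝ, ∀ τ : ℝ, 1 ≤ τ → ∀ v : H1, IsReducedSolution (fun _ => 1) τ f v →
      ∫ x in S, ‖grad v x‖ ^ 2 ≤ C * Real.exp (-τ * β) := by
  obtain ⟨ε, hε, hβε⟩ : ∃ ε, 0 < ε ∧ β < 2 * (d - 2 * ε) :=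
    ⟨(2 * d - β) / 8, by linarith, by linarith⟩
  obtain ⟨θ, hθ, hθ1, hβθ⟩ : ∃ θ : ℝ, 0 ≤ θ ∧ θ < 1 ∧ β ≤ θ * (2 * (d - 2 * ε)) := by
    rcases le_or_gt β 0 with h0 | hpos
    · exact ⟨0, le_rfl, one_pos, by simpa using h0⟩
    · have hpos' := hpos.trans hβε
      exact ⟨β / (2 * (d - 2 * ε)), by positivity, (div_lt_one hpos').2 hβε,
        (div_mul_cancel₀ _ hpos'.ne').ge⟩
  obtain ⟨t, ht, hcov⟩ := hS.elim_nhds_subcover (fun x => Metric.ball x ε)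
    fun x _ => Metric.ball_mem_nhds x hε
  refine ⟨t.card * (‖f‖ ^ 2 / (1 - θ)), fun τ hτ v hv => ?_⟩
  rw [mul_assoc]
  refine setIntegral_le_card_mul hcov (integrable_norm_sq _) (fun _ => sq_nonneg _) fun x hx => ?_
  rw [div_mul_eq_mul_div, le_div_iff₀' (sub_pos.2 hθ1)]
  refine (hv.mul_setIntegral_ball_le hτ hθ hθ1.le hε (hf x (ht x hx))).trans ?_
  exact mul_le_mul_of_nonneg_left (Real.exp_le_exp.2 (mul_le_mul_of_nonpos_left
    (hβθ.trans_eq (by ring)) (by linarith))) (sq_nonneg _)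

theorem differentiableAt_deriv_of_contDiffAt {F : ℝ → ℝ} {r : ℝ} (hF : ContDiffAt ℝ 2 F r) :
    DifferentiableAt ℝ (deriv F) r :=
  ((hF.fderiv_right (m := 1) (by norm_num)).differentiableAt one_ne_zero).clm_apply
    (differentiableAt_const (1 : ℝ))

/-! ### The cut-off Yukawa kernel -/

section RadialLaplacian

variable {E : Type*} [NormedAddCommGroup E] [InnerProductSpace ℝ E]

theorem laplacian_eq_sum_fderiv [FiniteDimensional ℝ E] {ι : Type*} [Fintype ι]
    (b : OrthonormalBasis ι ℝ E) {g : E → ℝ} {x : E} (hg : ContDiffAt ℝ 2 g x) :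
    Δ g x = ∑ i, fderiv ℝ (fun y => fderiv ℝ g y (b i)) x (b i) := by
  have hd : DifferentiableAt ℝ (fderiv ℝ g) x :=
    (hg.fderiv_right (m := 1) (by norm_num)).differentiableAt one_ne_zero
  rw [InnerProductSpace.laplacian_eq_iteratedFDeriv_orthonormalBasis g b]
  refine Finset.sum_congr rfl fun i _ => ?_
  rw [iteratedFDeriv_two_apply, fderiv_clm_apply hd (differentiableAt_const _)]
  simp

theorem hasFDerivAt_norm_sub {x x₀ : E} (hx : x ≠ x₀) :
    HasFDerivAt (fun y => ‖y - x₀‖) (‖x - x₀‖⁻¹ • innerSL ℝ (x - x₀)) x := by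
  have hr : 0 < ‖x - x₀‖ := norm_sub_pos_iff.2 hx
  have h := (((hasFDerivAt_id x).sub_const x₀).norm_sq).sqrt (pow_pos hr 2).ne'
  simp only [id_eq, Real.sqrt_sq (norm_nonneg _)] at h
  refine h.congr_fderiv ?_
  ext y
  simp
  field_simp

theorem fderiv_comp_norm_sub {x x₀ : E} (hx : x ≠ x₀) {F : ℝ → ℝ}
    (hF : DifferentiableAt ℝ F ‖x - x₀‖) (e : E) :
    fderiv ℝ (fun y => F ‖y - x₀‖) x e = deriv F ‖x - x₀‖ / ‖x - x₀‖ * inner ℝ (x - x₀) e := by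
  have h := (hF.hasDerivAt.comp_hasFDerivAt x (hasFDerivAt_norm_sub hx)).fderiv
  rw [Function.comp_def] at h
  rw [h, smul_apply, smul_apply, innerSL_apply_apply, smul_eq_mul, smul_eq_mul, div_eq_mul_inv,
    mul_assoc]

theorem laplacian_comp_norm_sub [FiniteDimensional ℝ E] {x x₀ : E} (hx : x ≠ x₀) {F : ℝ → ℝ}
    (hF : ContDiffAt ℝ 2 F ‖x - x₀‖) :
    Δ (fun y => F ‖y - x₀‖) x = deriv (deriv F) ‖x - x₀‖
      + (Module.finrank ℝ E - 1) * deriv F ‖x - x₀‖ / ‖x - x₀‖ := by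
  set r := ‖x - x₀‖ with hr_def
  have hr : 0 < r := norm_sub_pos_iff.2 hx
  have hnorm : ContDiffAt ℝ 2 (fun y => ‖y - x₀‖) x :=
    (contDiffAt_id.sub contDiffAt_const).norm ℝ (sub_ne_zero.2 hx)
  have hF' := differentiableAt_deriv_of_contDiffAt hF
  have hG : HasDerivAt (fun ρ => deriv F ρ / ρ)
      ((deriv (deriv F) r * r - deriv F r) / r ^ 2) r := by
    simpa only [id_eq, mul_one] using hF'.hasDerivAt.fun_div (hasDerivAt_id' r) hr.ne'
  have hgrad : ∀ e, (fun y => fderiv ℝ (fun y => F ‖y - x₀‖) y e)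
      =ᶠ[𝓝 x] fun y => deriv F ‖y - x₀‖ / ‖y - x₀‖ * inner ℝ (y - x₀) e := by
    intro e
    filter_upwards [hnorm.continuousAt.eventually (hF.eventually (by simp)),
      isOpen_ne.mem_nhds hx] with y hy hne
    exact fderiv_comp_norm_sub hne (hy.differentiableAt two_ne_zero) e
  have hsecond : ∀ e : E, fderiv ℝ (fun y => fderiv ℝ (fun y => F ‖y - x₀‖) y e) x e
      = (deriv (deriv F) r * r - deriv F r) / r ^ 2 / r * inner ℝ (x - x₀) e ^ 2
        + deriv F r / r * ‖e‖ ^ 2 := by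
    intro e
    have hinner : HasFDerivAt (fun y => (inner ℝ (y - x₀) e : ℝ)) (innerSL ℝ e) x := by
      simp only [real_inner_comm e]
      exact (innerSL ℝ e).hasFDerivAt.comp x ((hasFDerivAt_id x).sub_const x₀)
    have h := (hG.comp_hasFDerivAt x (hasFDerivAt_norm_sub hx)).fun_mul hinner
    simp only [Function.comp_def] at h
    rw [(hgrad e).fderiv_eq, h.fderiv, add_apply, smul_apply, smul_apply, smul_apply, smul_apply,
      innerSL_apply_apply, innerSL_apply_apply, real_inner_self_eq_norm_sq]
    simp only [smul_eq_mul, ← hr_def]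
    ring
  rw [laplacian_eq_sum_fderiv (stdOrthonormalBasis ℝ E) 
    (hF.fun_comp x hnorm)]
  simp only [hsecond, Finset.sum_add_distrib, ← Finset.mul_sum,
    OrthonormalBasis.sum_sq_inner_left, OrthonormalBasis.norm_eq_one]
  rw [← hr_def, Finset.sum_const, Finset.card_univ, Fintype.card_fin, nsmul_eq_mul]
  field_simp
  ring

theorem laplacian_div_norm_sub [FiniteDimensional ℝ E] (hdim : Module.finrank ℝ E = 3) {x x₀ : E}
    (hx : x ≠ x₀) {φ : ℝ → ℝ} (hφ : ContDiffAt ℝ 2 φ ‖x - x₀‖) :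
    Δ (fun y => φ ‖y - x₀‖ / ‖y - x₀‖) x = deriv (deriv φ) ‖x - x₀‖ / ‖x - x₀‖ := by
  have hr : 0 < ‖x - x₀‖ := norm_sub_pos_iff.2 hx
  set r := ‖x - x₀‖ with hr_def
  have hφ' := differentiableAt_deriv_of_contDiffAt hφ
  have hfirst : deriv (fun ρ => φ ρ / ρ) =ᶠ[𝓝 r] fun ρ => (deriv φ ρ * ρ - φ ρ) / ρ ^ 2 := by
    filter_upwards [hφ.eventually (by simp), isOpen_ne.mem_nhds hr.ne'] with ρ hρ hne
    simpa only [id_eq, mul_one] using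
      ((hρ.differentiableAt two_ne_zero).hasDerivAt.fun_div (hasDerivAt_id' ρ) hne).deriv
  have hsecond : HasDerivAt (fun ρ => (deriv φ ρ * ρ - φ ρ) / ρ ^ 2)
      ((deriv (deriv φ) r * r * r ^ 2 - (deriv φ r * r - φ r) * (2 * r)) / (r ^ 2) ^ 2) r := by
    have hnum := (hφ'.hasDerivAt.fun_mul (hasDerivAt_id' r)).fun_sub
      (hφ.differentiableAt two_ne_zero).hasDerivAt
    exact (hnum.fun_div (hasDerivAt_pow 2 r) (pow_pos hr 2).ne').congr_deriv (by simp)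
  rw [laplacian_comp_norm_sub hx (F := fun ρ => φ ρ / ρ) (hφ.fun_div contDiffAt_id hr.ne'), hdim,
    ← hr_def, hfirst.deriv_eq, hsecond.deriv, hfirst.self_of_nhds]
  field_simp
  push_cast
  ring

end RadialLaplacian

theorem laplacian_eq_sum_fderiv_single {z : E3 → ℝ} (hz : ContDiff ℝ ∞ z) (x : E3) :
    Δ z x = ∑ i, fderiv ℝ (fun y => fderiv ℝ z y (EuclideanSpace.single i 1)) x
      (EuclideanSpace.single i 1) := by
  simpa only [EuclideanSpace.basisFun_apply] using
    laplacian_eq_sum_fderiv (EuclideanSpace.basisFun (Fin 3) ℝ)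
      (contDiff_infty.1 hz 2).contDiffAt

theorem memLp_laplacian {z : E3 → ℝ} (hz : ContDiff ℝ ∞ z) (hc : HasCompactSupport z) :
    MemLp (Δ z) 2 (volume : Measure E3) := by
  refine (memLp_finsetSum Finset.univ fun i _ => memLp_test_deriv
    ((hz.fderiv_right (m := ∞) (by simp)).clm_apply contDiff_const)
    (hc.fderiv_apply (𝕜 := ℝ) (EuclideanSpace.single i 1)) (EuclideanSpace.single i 1)).ae_eq ?_
  exact Eventually.of_forall fun x => by simp only [laplacian_eq_sum_fderiv_single hz]

theorem inner_grad_ofTest (v : H1) {z : E3 → ℝ} (hz : ContDiff ℝ ∞ z) (hc : HasCompactSupport z) :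
    inner ℝ (grad v) (grad (ofTest hz hc)) = -∫ x, toL2 v x * Δ z x := by
  have hcoord : ∀ i : Fin 3, ∫ x, grad v x i * fderiv ℝ z x (EuclideanSpace.single i 1)
      = -∫ x, toL2 v x * fderiv ℝ (fun y => fderiv ℝ z y (EuclideanSpace.single i 1)) x
        (EuclideanSpace.single i 1) := fun i => by
    rw [isWeakGradient_grad v _ ((hz.fderiv_right (m := ∞) (by simp)).clm_apply contDiff_const)
      (hc.fderiv_apply (𝕜 := ℝ) _), neg_neg]
  calc inner ℝ (grad v) (grad (ofTest hz hc))
      = ∫ x, ∑ i, grad v x i * fderiv ℝ z x (EuclideanSpace.single i 1) := by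
        rw [L2.inner_def]
        refine integral_congr_ae ?_
        filter_upwards [grad_ofTest hz hc] with x hx
        simp only [hx, PiLp.inner_apply, gradient_apply_coord, RCLike.inner_apply, conj_trivial,
          mul_comm]
    _ = ∑ i, ∫ x, grad v x i * fderiv ℝ z x (EuclideanSpace.single i 1) :=
        integral_finsetSum _ fun i _ =>
          (memLp_coord (grad v) i).integrable_mul (memLp_test_deriv hz hc _)
    _ = -∫ x, toL2 v x * Δ z x := by
        simp only [hcoord, laplacian_eq_sum_fderiv_single hz, Finset.mul_sum]
        rw [integral_finsetSum, Finset.sum_neg_distrib]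
        exact fun i _ => (Lp.memLp (toL2 v)).integrable_mul (memLp_test_deriv
          ((hz.fderiv_right (m := ∞) (by simp)).clm_apply contDiff_const)
          (hc.fderiv_apply (𝕜 := ℝ) _) _)

theorem IsReducedSolution.integral_mul_test {τ : ℝ} {f : L2} {v : H1}
    (hv : IsReducedSolution (fun _ => 1) τ f v) {z : E3 → ℝ} (hz : ContDiff ℝ ∞ z)
    (hc : HasCompactSupport z) : ∫ x, f x * z x = -∫ x, toL2 v x * (Δ z x - τ ^ 2 * z x) := by
  have htest : ∀ g : L2, inner ℝ g (toL2 (ofTest hz hc)) = ∫ x, g x * z x := fun g => by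
    rw [← integral_mul_eq_inner]
    refine integral_congr_ae ?_
    filter_upwards [toL2_ofTest hz hc] with x hx
    rw [hx]
  have hΔ : Integrable fun x => toL2 v x * Δ z x :=
    (Lp.memLp _).integrable_mul (memLp_laplacian hz hc)
  have hτ : Integrable fun x => toL2 v x * (τ ^ 2 * z x) :=
    (Lp.memLp _).integrable_mul ((memLp_test hz hc).const_mul _)
  have heq := isReducedSolution_iff.1 hv (ofTest hz hc)
  rw [reducedForm, form_one, inner_grad_ofTest, htest, htest, ← integral_const_mul] at heq
  simp only [mul_sub]
  rw [integral_sub hΔ hτ, ← heq]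
  simp only [mul_left_comm]
  ring

section CutoffYukawa

variable {s : ℝ} (χ : ContDiffBump s)

/-- The Yukawa kernel `e^{-τ |x - x₀|} / |x - x₀|`, which solves `Δ z = τ² z` off `x₀` in dimension
three, cut off by `χ(|x - x₀|)` to a shell around `x₀`. -/
def cutoffYukawa (τ : ℝ) (x₀ x : E3) : ℝ := χ ‖x - x₀‖ * Real.exp (-τ * ‖x - x₀‖) / ‖x - x₀‖

theorem cutoffYukawa_eq_zero (τ : ℝ) {x₀ x : E3} (h : χ.rOut ≤ |‖x - x₀‖ - s|) :
    cutoffYukawa χ τ x₀ x = 0 := by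
  rw [cutoffYukawa, χ.zero_of_le_dist h, zero_mul, zero_div]

theorem cutoffYukawa_nonneg (τ : ℝ) (x₀ x : E3) : 0 ≤ cutoffYukawa χ τ x₀ x :=
  div_nonneg (mul_nonneg χ.nonneg (Real.exp_pos _).le) (norm_nonneg _)

theorem le_cutoffYukawa {τ R : ℝ} (hτ : 0 ≤ τ) {x₀ x : E3} (hpos : 0 < ‖x - x₀‖)
    (hR : ‖x - x₀‖ ≤ R) (hx : |‖x - x₀‖ - s| ≤ χ.rIn) :
    Real.exp (-τ * R) / R ≤ cutoffYukawa χ τ x₀ x := by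
  rw [cutoffYukawa, χ.one_of_mem_closedBall hx, one_mul]
  exact div_le_div₀ (Real.exp_pos _).le
    (Real.exp_le_exp.2 (mul_le_mul_of_nonpos_left hR (neg_nonpos.2 hτ))) hpos hR

theorem hasCompactSupport_cutoffYukawa (τ : ℝ) (x₀ : E3) :
    HasCompactSupport (cutoffYukawa χ τ x₀) := by
  refine HasCompactSupport.intro (isCompact_closedBall x₀ (s + χ.rOut)) fun x hx => ?_
  rw [Metric.mem_closedBall, dist_eq_norm, not_le] at hx
  exact cutoffYukawa_eq_zero χ τ (le_abs.2 (Or.inl (by linarith)))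

theorem cutoffYukawa_eventuallyEq_zero (hχ : χ.rOut < s) (τ : ℝ) (x₀ : E3) :
    cutoffYukawa χ τ x₀ =ᶠ[𝓝 x₀] fun _ => 0 := by
  filter_upwards [Metric.ball_mem_nhds x₀ (sub_pos.2 hχ)] with y hy
  rw [Metric.mem_ball, dist_eq_norm] at hy
  exact cutoffYukawa_eq_zero χ τ (le_abs.2 (Or.inr (by linarith)))

theorem contDiff_cutoffYukawa (hχ : χ.rOut < s) (τ : ℝ) (x₀ : E3) :
    ContDiff ℝ ∞ (cutoffYukawa χ τ x₀) := by
  refine contDiff_iff_contDiffAt.2 fun x => ?_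
  rcases eq_or_ne x x₀ with rfl | hx
  · exact contDiffAt_const.congr_of_eventuallyEq (cutoffYukawa_eventuallyEq_zero χ hχ τ x)
  · have hnorm : ContDiffAt ℝ ∞ (fun y => ‖y - x₀‖) x :=
      (contDiffAt_id.sub contDiffAt_const).norm ℝ (sub_ne_zero.2 hx)
    exact ((χ.contDiffAt.fun_comp x hnorm).mul (contDiffAt_const.mul hnorm).exp).div hnorm
      (norm_sub_pos_iff.2 hx).ne'

theorem laplacian_cutoffYukawa_sub (τ : ℝ) {x₀ x : E3} (hx : x ≠ x₀) :
    Δ (cutoffYukawa χ τ x₀) x - τ ^ 2 * cutoffYukawa χ τ x₀ x =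
      (deriv (deriv χ) ‖x - x₀‖ - 2 * τ * deriv χ ‖x - x₀‖)
        * (Real.exp (-τ * ‖x - x₀‖) / ‖x - x₀‖) := by
  have hχ : ContDiff ℝ 2 χ := χ.contDiff
  have hexp : ∀ ρ, HasDerivAt (fun ρ => Real.exp (-τ * ρ)) (-τ * Real.exp (-τ * ρ)) ρ := fun ρ =>
    ((hasDerivAt_id' ρ).const_mul (-τ)).exp.congr_deriv (by ring)
  have hfirst : deriv (fun ρ => χ ρ * Real.exp (-τ * ρ))
      = fun ρ => (deriv χ ρ - τ * χ ρ) * Real.exp (-τ * ρ) := by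
    funext ρ
    rw [((hχ.differentiable two_ne_zero ρ).hasDerivAt.fun_mul (hexp ρ)).deriv]
    ring
  have hsecond : ∀ ρ, deriv (deriv (fun ρ => χ ρ * Real.exp (-τ * ρ))) ρ
      = (deriv (deriv χ) ρ - 2 * τ * deriv χ ρ + τ ^ 2 * χ ρ) * Real.exp (-τ * ρ) := by
    intro ρ
    have hd := (differentiableAt_deriv_of_contDiffAt hχ.contDiffAt).hasDerivAt.fun_sub
      ((hχ.differentiable two_ne_zero ρ).hasDerivAt.const_mul τ)
    rw [hfirst, (hd.fun_mul (hexp ρ)).deriv]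
    ring
  have hΔ := laplacian_div_norm_sub (E := E3) (by simp) hx
    (φ := fun ρ => χ ρ * Real.exp (-τ * ρ))
    (hχ.mul (contDiff_const.mul contDiff_id).exp).contDiffAt
  change Δ (fun y => χ ‖y - x₀‖ * Real.exp (-τ * ‖y - x₀‖) / ‖y - x₀‖) x - _ = _
  rw [hΔ, hsecond, cutoffYukawa]
  ring

theorem deriv_bump_eq_zero {r : ℝ} (hr : |r - s| < χ.rIn ∨ χ.rOut < |r - s|) :
    deriv χ r = 0 ∧ deriv (deriv χ) r = 0 := by
  obtain ⟨k, hk⟩ : ∃ k : ℝ, χ =ᶠ[𝓝 r] fun _ => k := by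
    rcases hr with h | h
    · exact ⟨1, χ.eventuallyEq_one_of_mem_ball h⟩
    · refine ⟨0, ?_⟩
      have hcont : Continuous fun y => |y - s| := by fun_prop
      filter_upwards [hcont.continuousAt.eventually (lt_mem_nhds h)] with y hy
      exact χ.zero_of_le_dist hy.le
  have hk' : deriv χ =ᶠ[𝓝 r] fun _ => 0 := by simpa using hk.deriv
  exact ⟨hk'.self_of_nhds, by simpa using hk'.deriv_eq⟩

theorem laplacian_cutoffYukawa_sub_eq_zero (hχ : χ.rOut < s) (τ : ℝ) {x₀ x : E3}
    (h : |‖x - x₀‖ - s| < χ.rIn ∨ χ.rOut < |‖x - x₀‖ - s|) :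
    Δ (cutoffYukawa χ τ x₀) x - τ ^ 2 * cutoffYukawa χ τ x₀ x = 0 := by
  rcases eq_or_ne x x₀ with rfl | hx
  · have hzero := cutoffYukawa_eventuallyEq_zero χ hχ τ x
    rw [(InnerProductSpace.laplacian_congr_nhds hzero).self_of_nhds, hzero.self_of_nhds,
      InnerProductSpace.laplacian_const]
    simp
  · obtain ⟨h₁, h₂⟩ := deriv_bump_eq_zero χ h
    rw [laplacian_cutoffYukawa_sub χ τ hx, h₁, h₂]
    ring

theorem exists_abs_laplacian_cutoffYukawa_sub_le (hχ : χ.rOut < s) :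
    ∃ C : ℝ, ∀ τ : ℝ, 1 ≤ τ → ∀ x₀ x : E3,
      |Δ (cutoffYukawa χ τ x₀) x - τ ^ 2 * cutoffYukawa χ τ x₀ x|
        ≤ C * τ * Real.exp (-τ * ‖x - x₀‖) := by
  have hdiff : ContDiff ℝ ∞ (deriv χ) := (contDiff_infty_iff_deriv.1 χ.contDiff).2
  obtain ⟨M₁, hM₁⟩ := χ.hasCompactSupport.deriv.exists_bound_of_continuous hdiff.continuous
  obtain ⟨M₂, hM₂⟩ := χ.hasCompactSupport.deriv.deriv.exists_bound_of_continuous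
    (hdiff.continuous_deriv (by simp))
  have hM₁0 : 0 ≤ M₁ := (norm_nonneg _).trans (hM₁ 0)
  have hM₂0 : 0 ≤ M₂ := (norm_nonneg _).trans (hM₂ 0)
  have hinner : 0 < s - χ.rOut := sub_pos.2 hχ
  refine ⟨(M₂ + 2 * M₁) / (s - χ.rOut), fun τ hτ x₀ x => ?_⟩
  have hτ0 : 0 ≤ τ := by linarith
  rcases lt_or_ge ‖x - x₀‖ (s - χ.rOut) with hr | hr
  · rw [laplacian_cutoffYukawa_sub_eq_zero χ hχ τ (Or.inr (lt_abs.2 (Or.inr (by linarith)))),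
      abs_zero]
    positivity
  · have hx : x ≠ x₀ := norm_sub_pos_iff.1 (hinner.trans_le hr)
    have hbump : |deriv (deriv χ) ‖x - x₀‖ - 2 * τ * deriv χ ‖x - x₀‖| ≤ (M₂ + 2 * M₁) * τ := by
      calc |deriv (deriv χ) ‖x - x₀‖ - 2 * τ * deriv χ ‖x - x₀‖|
          ≤ |deriv (deriv χ) ‖x - x₀‖| + |2 * τ * deriv χ ‖x - x₀‖| := abs_sub _ _
        _ ≤ M₂ + 2 * τ * M₁ := by
            rw [abs_mul, abs_of_nonneg (by positivity : 0 ≤ 2 * τ)]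
            gcongr
            · exact hM₂ _
            · exact hM₁ _
        _ ≤ (M₂ + 2 * M₁) * τ := by nlinarith
    rw [laplacian_cutoffYukawa_sub χ τ hx, abs_mul, abs_of_nonneg (by positivity :
      0 ≤ Real.exp (-τ * ‖x - x₀‖) / ‖x - x₀‖)]
    calc _ ≤ (M₂ + 2 * M₁) * τ * (Real.exp (-τ * ‖x - x₀‖) / (s - χ.rOut)) := by gcongr
      _ = _ := by ring

theorem exists_sq_laplacian_cutoffYukawa_sub_le (hχ : χ.rOut < s) :
    ∃ C : ℝ, ∀ τ : ℝ, 1 ≤ τ → ∀ x₀ x : E3,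
      (Δ (cutoffYukawa χ τ x₀) x - τ ^ 2 * cutoffYukawa χ τ x₀ x) ^ 2
        ≤ (C * τ) ^ 2 * ((Metric.closedBall x₀ (s - χ.rIn)).indicator (fun _ => 1) x
          + Real.exp (-τ * (2 * (s + χ.rIn)))) := by
  obtain ⟨C, hC⟩ := exists_abs_laplacian_cutoffYukawa_sub_le χ hχ
  refine ⟨C, fun τ hτ x₀ x => ?_⟩
  have hind : 0 ≤ (Metric.closedBall x₀ (s - χ.rIn)).indicator (fun _ => (1 : ℝ)) x :=
    indicator_nonneg (fun _ _ => zero_le_one) x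
  rcases lt_or_ge |‖x - x₀‖ - s| χ.rIn with hshell | hshell
  · rw [laplacian_cutoffYukawa_sub_eq_zero χ hχ τ (Or.inl hshell), sq, zero_mul]
    positivity
  refine (sq_abs _).symm.trans_le ((pow_le_pow_left₀ (abs_nonneg _) (hC τ hτ x₀ x) 2).trans ?_)
  rw [mul_pow, ← Real.exp_nat_mul]
  refine mul_le_mul_of_nonneg_left ?_ (sq_nonneg _)
  rcases le_abs.1 hshell with houter | hinner
  · refine (Real.exp_le_exp.2 ?_).trans (le_add_of_nonneg_left hind)
    push_cast
    nlinarith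
  · have hx : x ∈ Metric.closedBall x₀ (s - χ.rIn) := by
      rw [Metric.mem_closedBall, dist_eq_norm]
      linarith
    rw [indicator_of_mem hx]
    refine (Real.exp_le_one_iff.2 ?_).trans (le_add_of_nonneg_right (Real.exp_pos _).le)
    push_cast
    nlinarith [norm_nonneg (x - x₀)]

end CutoffYukawa

theorem sq_setIntegral_le {α : Type*} [MeasurableSpace α] {μ : Measure α} {U : Set α}
    (hU : MeasurableSet U) (hμU : μ U ≠ ⊤) {h : α → ℝ} (hh : MemLp h 2 μ) :
    (∫ x in U, h x ∂μ) ^ 2 ≤ μ.real U * ∫ x, ‖h x‖ ^ 2 ∂μ := by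
  have hpair : ∫ x in U, h x ∂μ = inner ℝ (indicatorConstLp 2 hU hμU 1) hh.toLp := by
    rw [L2.inner_indicatorConstLp_one]
    exact setIntegral_congr_ae hU (hh.coeFn_toLp.mono fun x hx _ => hx.symm)
  have hnorm : ‖hh.toLp‖ ^ 2 = ∫ x, ‖h x‖ ^ 2 ∂μ := by
    rw [norm_sq_eq_integral]
    exact integral_congr_ae (hh.coeFn_toLp.fun_comp fun y => ‖y‖ ^ 2)
  have hone : ‖(indicatorConstLp 2 hU hμU (1 : ℝ) : Lp ℝ 2 μ)‖ ^ 2 = μ.real U := by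
    rw [norm_indicatorConstLp two_ne_zero ENNReal.ofNat_ne_top, norm_one, one_mul,
      ← Real.rpow_natCast, ← Real.rpow_mul measureReal_nonneg]
    simp
  rw [hpair, ← hnorm, ← hone, ← mul_pow]
  exact (sq_abs _).symm.trans_le (pow_le_pow_left₀ (abs_nonneg _) (abs_real_inner_le_norm _ _) 2)

theorem sq_integral_mul_le {α : Type*} [MeasurableSpace α] {μ : Measure α} {U S : Set α}
    (hU : MeasurableSet U) (hμU : μ U ≠ ⊤) (hS : MeasurableSet S) (v : Lp ℝ 2 μ) {g : α → ℝ}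
    (hg : AEStronglyMeasurable g μ) (hgU : ∀ x ∉ U, g x = 0) {a ε : ℝ}
    (hle : ∀ x, g x ^ 2 ≤ a ^ 2 * (S.indicator (fun _ => 1) x + ε)) :
    (∫ x, v x * g x ∂μ) ^ 2 ≤ μ.real U * (a ^ 2 * ((∫ x in S, ‖v x‖ ^ 2 ∂μ) + ε * ‖v‖ ^ 2)) := by
  have hpointwise : ∀ x, ‖v x * g x‖ ^ 2
      ≤ a ^ 2 * (S.indicator (fun x => ‖v x‖ ^ 2) x + ε * ‖v x‖ ^ 2) := by
    intro x
    have hind : S.indicator (fun x => ‖v x‖ ^ 2) x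
        = ‖v x‖ ^ 2 * S.indicator (fun _ => 1) x := by
      by_cases hx : x ∈ S
      · rw [indicator_of_mem hx, indicator_of_mem hx, mul_one]
      · rw [indicator_of_notMem hx, indicator_of_notMem hx, mul_zero]
    rw [norm_mul, mul_pow, Real.norm_eq_abs (g x), sq_abs, hind]
    exact (mul_le_mul_of_nonneg_left (hle x) (sq_nonneg _)).trans_eq (by ring)
  have hbound : Integrable
      (fun x => a ^ 2 * (S.indicator (fun x => ‖v x‖ ^ 2) x + ε * ‖v x‖ ^ 2)) μ :=
    (((integrable_norm_sq v).indicator hS).add ((integrable_norm_sq v).const_mul ε)).const_mul _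
  have hmeas : AEStronglyMeasurable (fun x => v x * g x) μ :=
    (Lp.aestronglyMeasurable v).mul hg
  have hsq : Integrable (fun x => ‖v x * g x‖ ^ 2) μ :=
    hbound.mono' (hmeas.norm.pow 2) (Eventually.of_forall fun x => by
      rw [Real.norm_of_nonneg (sq_nonneg _)]
      exact hpointwise x)
  rw [← setIntegral_eq_integral_of_forall_compl_eq_zero (s := U)
    fun x hx => by rw [hgU x hx, mul_zero]]
  refine (sq_setIntegral_le hU hμU ((memLp_two_iff_integrable_sq_norm hmeas).2 hsq)).trans
    (mul_le_mul_of_nonneg_left ((integral_mono hsq hbound hpointwise).trans_eq ?_)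
      measureReal_nonneg)
  rw [integral_const_mul, integral_add ((integrable_norm_sq v).indicator hS)
    ((integrable_norm_sq v).const_mul ε), integral_indicator hS, integral_const_mul,
    norm_sq_eq_integral]

theorem exists_sq_integral_mul_cutoffYukawa_le {s : ℝ} (χ : ContDiffBump s) (hχ : χ.rOut < s)
    (x₀ : E3) (f : L2) :
    ∃ C : ℝ, 0 ≤ C ∧ ∀ τ : ℝ, 1 ≤ τ → ∀ v : H1, IsReducedSolution (fun _ => 1) τ f v →
      (∫ x, f x * cutoffYukawa χ τ x₀ x) ^ 2
        ≤ C * τ ^ 2 * ((∫ x in Metric.closedBall x₀ (s - χ.rIn), ‖toL2 v x‖ ^ 2)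
          + Real.exp (-τ * (2 * (s + χ.rIn)))) := by
  obtain ⟨C, hC⟩ := exists_sq_laplacian_cutoffYukawa_sub_le χ hχ
  set V := volume.real (Metric.closedBall x₀ (s + χ.rOut))
  refine ⟨V * C ^ 2 * (1 + ‖f‖ ^ 2), by positivity, fun τ hτ v hv => ?_⟩
  set A := ∫ x in Metric.closedBall x₀ (s - χ.rIn), ‖toL2 v x‖ ^ 2
  set ε := Real.exp (-τ * (2 * (s + χ.rIn)))
  have hA0 : 0 ≤ A := integral_nonneg fun _ => sq_nonneg _
  have hz := contDiff_cutoffYukawa χ hχ τ x₀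
  have hc := hasCompactSupport_cutoffYukawa χ τ x₀
  have hsupp : ∀ x ∉ Metric.closedBall x₀ (s + χ.rOut),
      Δ (cutoffYukawa χ τ x₀) x - τ ^ 2 * cutoffYukawa χ τ x₀ x = 0 := by
    intro x hx
    rw [Metric.mem_closedBall, dist_eq_norm, not_le] at hx
    exact laplacian_cutoffYukawa_sub_eq_zero χ hχ τ (Or.inr (lt_abs.2 (Or.inl (by linarith))))
  have hmeas := ((memLp_laplacian hz hc).sub ((memLp_test hz hc).const_mul (τ ^ 2))).1
  calc (∫ x, f x * cutoffYukawa χ τ x₀ x) ^ 2 ≤ V * ((C * τ) ^ 2 * (A + ε * ‖toL2 v‖ ^ 2)) := by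
        rw [hv.integral_mul_test hz hc, neg_sq]
        exact sq_integral_mul_le measurableSet_closedBall measure_closedBall_lt_top.ne
          measurableSet_closedBall (toL2 v) hmeas hsupp (hC τ hτ x₀)
    _ ≤ V * ((C * τ) ^ 2 * (A + ε * ‖f‖ ^ 2)) := by
        gcongr
        exact hv.norm_toL2_le isCoefficient_one hτ
    _ ≤ V * ((C * τ) ^ 2 * ((1 + ‖f‖ ^ 2) * (A + ε))) := by
        gcongr
        nlinarith [mul_nonneg (sq_nonneg ‖f‖) hA0, Real.exp_pos (-τ * (2 * (s + χ.rIn)))]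
    _ = V * C ^ 2 * (1 + ‖f‖ ^ 2) * τ ^ 2 * (A + ε) := by ring

theorem mul_sq_sub_le_inner_add {E : Type*} [NormedAddCommGroup E] [InnerProductSpace ℝ E]
    {τ k m s : ℝ} (hτ : 1 ≤ τ) (hk : 0 ≤ k) (hm : 0 ≤ m) {p g : E} (hg : ‖g‖ ^ 2 ≤ k * m) :
    m * s ^ 2 - k * ‖p‖ ^ 2 ≤ 2 * (inner ℝ p (m • p + s • g) + τ ^ 2 * (s * (m * s))) := by
  have hcross : |2 * (s * inner ℝ p g)| ≤ m * s ^ 2 + k * ‖p‖ ^ 2 := by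
    refine abs_le_of_sq_le_sq ?_ (by positivity)
    have hcs : inner ℝ p g ^ 2 ≤ ‖p‖ ^ 2 * (k * m) := by
      calc inner ℝ p g ^ 2 ≤ (‖p‖ * ‖g‖) ^ 2 := sq_le_sq.2 (by
            rw [abs_of_nonneg (by positivity : 0 ≤ ‖p‖ * ‖g‖)]
            exact abs_real_inner_le_norm p g)
        _ ≤ ‖p‖ ^ 2 * (k * m) := by
            rw [mul_pow]
            gcongr
    calc (2 * (s * inner ℝ p g)) ^ 2 = 4 * s ^ 2 * inner ℝ p g ^ 2 := by ring
      _ ≤ 4 * s ^ 2 * (‖p‖ ^ 2 * (k * m)) := by gcongr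
      _ ≤ (m * s ^ 2 + k * ‖p‖ ^ 2) ^ 2 := by nlinarith [sq_nonneg (m * s ^ 2 - k * ‖p‖ ^ 2)]
  have hτ2 : m * s ^ 2 ≤ τ ^ 2 * (m * s ^ 2) :=
    le_mul_of_one_le_left (by positivity) (one_le_pow₀ hτ)
  have hp : 0 ≤ m * ‖p‖ ^ 2 := by positivity
  rw [inner_add_right, inner_smul_right, inner_smul_right, real_inner_self_eq_norm_sq]
  linarith [neg_le_of_abs_le hcross]

/-- The reverse Caccioppoli inequality: the reduced equation is tested with `m v` where `f` does not
see the weight `m`. -/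
theorem IsReducedSolution.integral_mul_norm_sq_toL2_le {τ : ℝ} {f : L2} {v : H1}
    (hv : IsReducedSolution (fun _ => 1) τ f v) (hτ : 1 ≤ τ) {m : E3 → ℝ}
    (hm : IsSmoothMultiplier m) (hm0 : ∀ x, 0 ≤ m x) (hfm : ∀ᵐ x : E3, f x = 0 ∨ m x = 0)
    {S : Set E3} (hS : MeasurableSet S) {k : ℝ} (hk : 0 ≤ k)
    (hgrad : ∀ x, ‖gradient m x‖ ^ 2 ≤ S.indicator (fun _ => k) x * m x) :
    ∫ x, m x * toL2 v x ^ 2 ≤ k * ∫ x in S, ‖grad v x‖ ^ 2 := by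
  have hL2 : Integrable fun x => toL2 v x * toL2 (v.mulLeft hm) x :=
    (Lp.memLp (toL2 v)).integrable_mul (Lp.memLp (toL2 (v.mulLeft hm)))
  have hmass : Integrable fun x => m x * toL2 v x ^ 2 :=
    (Lp.memLp (toL2 v)).integrable_sq.mul_of_top_right hm.memLp
  have henergy : Integrable (S.indicator fun x => k * ‖grad v x‖ ^ 2) :=
    ((integrable_norm_sq (grad v)).const_mul k).indicator hS
  have hgrad_int := L2.integrable_inner (𝕜 := ℝ) (grad v) (grad (v.mulLeft hm))
  have hsource : inner ℝ f (toL2 (v.mulLeft hm)) ≤ 0 := by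
    refine (inner_toL2_mulLeft_le hm le_rfl ?_ v).trans_eq (zero_mul _)
    exact hfm.mono fun x hx => hx.imp_right fun h => by rw [h, abs_zero]
  have htest : ∫ x, (m x * toL2 v x ^ 2 - S.indicator (fun x => k * ‖grad v x‖ ^ 2) x)
      ≤ 2 * inner ℝ f (toL2 (v.mulLeft hm)) := by
    rw [← isReducedSolution_iff.1 hv, reducedForm, form_one, L2.inner_def, ← integral_mul_eq_inner,
      ← integral_const_mul, ← integral_add hgrad_int (hL2.const_mul _), ← integral_const_mul]
    refine integral_mono_ae (hmass.sub henergy) ((hgrad_int.add (hL2.const_mul _)).const_mul 2) ?_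
    filter_upwards [H1.toL2_mulLeft hm v, H1.grad_mulLeft hm v] with x hx hgx
    have hk' : S.indicator (fun x => k * ‖grad v x‖ ^ 2) x
        = S.indicator (fun _ => k) x * ‖grad v x‖ ^ 2 := indicator_mul_left S (fun _ => k) _
    rw [hx, hgx, hk']
    exact mul_sq_sub_le_inner_add hτ (indicator_nonneg (fun _ _ => hk) x) (hm0 x) (hgrad x)
  rw [integral_sub hmass henergy, integral_indicator hS, integral_const_mul] at htest
  linarith

theorem gradient_sq {E : Type*} [NormedAddCommGroup E] [InnerProductSpace ℝ E] [CompleteSpace E]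
    {m : E → ℝ} {x : E} (hm : DifferentiableAt ℝ m x) :
    gradient (fun y => m y ^ 2) x = (2 * m x) • gradient m x := by
  have h : HasFDerivAt (fun y => m y ^ 2) _ x := hm.hasFDerivAt.pow 2
  rw [gradient, gradient, h.fderiv, ← map_smul]
  congr 1
  ext y
  simp

theorem exists_setIntegral_norm_sq_toL2_le (x₀ : E3) {r r₀ : ℝ} (hr : 0 < r) (hrr : r < r₀) :
    ∃ C : ℝ, 0 ≤ C ∧ ∀ (τ : ℝ) (f : L2) (v : H1), 1 ≤ τ → IsReducedSolution (fun _ => 1) τ f v →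
      (∀ᵐ x : E3, x ∈ Metric.ball x₀ r₀ → f x = 0) →
      ∫ x in Metric.closedBall x₀ r, ‖toL2 v x‖ ^ 2
        ≤ C * ∫ x in Metric.ball x₀ r₀, ‖grad v x‖ ^ 2 := by
  let ζ : ContDiffBump x₀ := ⟨r, r₀, hr, hrr⟩
  obtain ⟨M, hM⟩ := (hasCompactSupport_gradient ζ.hasCompactSupport).exists_bound_of_continuous
    (continuous_gradient ζ.contDiff)
  have hζ0 : ∀ x ∉ Metric.ball x₀ r₀, ζ x = 0 := fun x hx =>
    ζ.zero_of_le_dist (not_lt.1 hx)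
  have hζ2 : ContDiff ℝ ∞ fun x => ζ x ^ 2 := ζ.contDiff.pow 2
  have hζ2c : HasCompactSupport fun x => ζ x ^ 2 :=
    ζ.hasCompactSupport.comp_left (g := fun y => y ^ 2) (zero_pow two_ne_zero)
  have hm : IsSmoothMultiplier fun x => ζ x ^ 2 :=
    ⟨hζ2, hζ2.continuous.memLp_of_hasCompactSupport hζ2c,
      (continuous_gradient (hζ2.of_le (by simp))).memLp_of_hasCompactSupport
        (hasCompactSupport_gradient hζ2c)⟩
  refine ⟨4 * M ^ 2, by positivity, fun τ f v hτ hv hf => ?_⟩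
  have hmass : ∫ x in Metric.closedBall x₀ r, ‖toL2 v x‖ ^ 2 ≤ ∫ x, ζ x ^ 2 * toL2 v x ^ 2 := by
    have hint : Integrable fun x => ζ x ^ 2 * toL2 v x ^ 2 :=
      (Lp.memLp (toL2 v)).integrable_sq.mul_of_top_right hm.memLp
    calc ∫ x in Metric.closedBall x₀ r, ‖toL2 v x‖ ^ 2
        = ∫ x in Metric.closedBall x₀ r, ζ x ^ 2 * toL2 v x ^ 2 :=
          setIntegral_congr_fun measurableSet_closedBall fun x hx => by
            simp only [ζ.one_of_mem_closedBall hx, one_pow, one_mul, Real.norm_eq_abs, sq_abs]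
      _ ≤ ∫ x, ζ x ^ 2 * toL2 v x ^ 2 :=
          setIntegral_le_integral hint (Eventually.of_forall fun x => by positivity)
  refine hmass.trans (hv.integral_mul_norm_sq_toL2_le hτ hm (fun x => sq_nonneg _) ?_
    measurableSet_ball (by positivity) fun x => ?_)
  · filter_upwards [hf] with x hx
    by_cases hxb : x ∈ Metric.ball x₀ r₀
    · exact Or.inl (hx hxb)
    · exact Or.inr (by rw [hζ0 x hxb, zero_pow two_ne_zero])
  · rw [gradient_sq ((ζ.contDiff (n := 1)).differentiable one_ne_zero x)]
    by_cases hxb : x ∈ Metric.ball x₀ r₀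
    · rw [indicator_of_mem hxb, norm_smul, mul_pow, norm_mul, mul_pow]
      calc _ ≤ ‖(2 : ℝ)‖ ^ 2 * ‖ζ x‖ ^ 2 * M ^ 2 := by gcongr; exact hM x
        _ = _ := by
          rw [Real.norm_eq_abs, Real.norm_eq_abs, sq_abs, sq_abs]
          ring
    · simp [hζ0 x hxb]

theorem mul_mul_measureReal_le_integral_mul {α : Type*} [MeasurableSpace α] {μ : Measure α}
    {S : Set α} (hS : MeasurableSet S) (hμS : μ S ≠ ⊤) {g z : α → ℝ} {a b : ℝ} (ha : 0 ≤ a)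
    (hb : 0 ≤ b) (hgz : Integrable (fun x => g x * z x) μ) (hg : ∀ᵐ x ∂μ, 0 ≤ g x)
    (hz : ∀ x, 0 ≤ z x) (hgS : ∀ᵐ x ∂μ, x ∈ S → a ≤ g x) (hzS : ∀ x ∈ S, b ≤ z x) :
    a * b * μ.real S ≤ ∫ x, g x * z x ∂μ := by
  calc a * b * μ.real S = ∫ _x in S, a * b ∂μ := by
        rw [setIntegral_const, smul_eq_mul, mul_comm]
    _ ≤ ∫ x in S, g x * z x ∂μ := by
        refine setIntegral_mono_on_ae (integrableOn_const hμS) hgz.integrableOn hS ?_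
        filter_upwards [hgS] with x hx hxS
        exact mul_le_mul (hx hxS) (hzS x hxS) hb (ha.trans (hx hxS))
    _ ≤ ∫ x, g x * z x ∂μ := by
        refine setIntegral_le_integral hgz ?_
        filter_upwards [hg] with x hx
        exact mul_nonneg hx (hz x)

theorem eventually_exp_neg_mul_le_of_mul_exp_le {κ C a b c : ℝ} (hκ : 0 < κ) (hC : 0 ≤ C)
    (hab : a < b) (hbc : b ≤ c) : ∀ᶠ τ : ℝ in atTop, ∀ A : ℝ,
      κ * Real.exp (-τ * a) ≤ C * τ ^ 2 * (A + Real.exp (-τ * c)) → Real.exp (-τ * b) ≤ A := by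
  have hlim : Tendsto (fun τ : ℝ => 2 * C * (τ ^ 2 * Real.exp (-(b - a) * τ))) atTop (𝓝 0) := by
    have h := tendsto_rpow_mul_exp_neg_mul_atTop_nhds_zero 2 (b - a) (sub_pos.2 hab)
    simpa only [Real.rpow_two, mul_zero] using h.const_mul (2 * C)
  filter_upwards [hlim.eventually (gt_mem_nhds hκ), eventually_ge_atTop 0] with τ hτκ hτ A hA
  by_contra! hlt
  refine hA.not_gt ?_
  calc C * τ ^ 2 * (A + Real.exp (-τ * c))
      ≤ C * τ ^ 2 * (Real.exp (-τ * b) + Real.exp (-τ * b)) := by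
        gcongr C * τ ^ 2 * (?_ + Real.exp ?_)
        nlinarith
    _ = 2 * C * (τ ^ 2 * Real.exp (-(b - a) * τ)) * Real.exp (-τ * a) := by
        rw [show -τ * b = -(b - a) * τ + -τ * a by ring, Real.exp_add]
        ring
    _ < κ * Real.exp (-τ * a) := mul_lt_mul_of_pos_right hτκ (Real.exp_pos _)

section LowerBound

variable {x₀ y₀ : E3} {r₀ ρ R c₁ σ : ℝ} {f : L2}

theorem exists_mul_exp_le_sq_integral_mul_cutoffYukawa {s : ℝ} (χ : ContDiffBump s)
    (hχ : χ.rOut < s) (hρ : 0 < ρ) (hR : 0 < R) (hc₁ : 0 < c₁) (hσ : σ ^ 2 = 1)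
    (hfσ : ∀ᵐ x, 0 ≤ σ * f x) (hfc : ∀ᵐ x, x ∈ Metric.ball y₀ ρ → c₁ ≤ σ * f x)
    (hpos : ∀ x ∈ Metric.ball y₀ ρ, 0 < ‖x - x₀‖) (hle : ∀ x ∈ Metric.ball y₀ ρ, ‖x - x₀‖ ≤ R)
    (hin : ∀ x ∈ Metric.ball y₀ ρ, |‖x - x₀‖ - s| ≤ χ.rIn) :
    ∃ κ, 0 < κ ∧ ∀ τ, 0 ≤ τ →
      κ * Real.exp (-τ * (2 * R)) ≤ (∫ x, f x * cutoffYukawa χ τ x₀ x) ^ 2 := by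
  have hvol : 0 < volume.real (Metric.ball y₀ ρ) :=
    ENNReal.toReal_pos (Metric.measure_ball_pos volume y₀ hρ).ne' measure_ball_lt_top.ne
  refine ⟨(c₁ / R * volume.real (Metric.ball y₀ ρ)) ^ 2, by positivity, fun τ hτ => ?_⟩
  have hint : Integrable fun x => σ * f x * cutoffYukawa χ τ x₀ x :=
    ((Lp.memLp f).const_mul σ).integrable_mul (memLp_test (contDiff_cutoffYukawa χ hχ τ x₀)
      (hasCompactSupport_cutoffYukawa χ τ x₀))
  have hlower := mul_mul_measureReal_le_integral_mul measurableSet_ball measure_ball_lt_top.ne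
    hc₁.le (by positivity) hint hfσ (cutoffYukawa_nonneg χ τ x₀) hfc
    fun x hx => le_cutoffYukawa χ hτ (hpos x hx) (hle x hx) (hin x hx)
  calc (c₁ / R * volume.real (Metric.ball y₀ ρ)) ^ 2 * Real.exp (-τ * (2 * R))
      = (c₁ * (Real.exp (-τ * R) / R) * volume.real (Metric.ball y₀ ρ)) ^ 2 := by
        rw [show -τ * (2 * R) = -τ * R + -τ * R by ring, Real.exp_add]
        ring
    _ ≤ (∫ x, σ * f x * cutoffYukawa χ τ x₀ x) ^ 2 :=
        pow_le_pow_left₀ (by positivity) hlower 2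
    _ = (∫ x, f x * cutoffYukawa χ τ x₀ x) ^ 2 := by
        simp only [mul_assoc]
        rw [integral_const_mul, mul_pow, hσ, one_mul]

theorem eventually_exp_le_setIntegral_norm_sq_grad (hr₀ : 0 < r₀) (hρ : 0 < ρ) (hc₁ : 0 < c₁)
    (hσ : σ ^ 2 = 1) (hf₀ : ∀ᵐ x, x ∈ Metric.ball x₀ r₀ → f x = 0) (hfσ : ∀ᵐ x, 0 ≤ σ * f x)
    (hfc : ∀ᵐ x, x ∈ Metric.ball y₀ ρ → c₁ ≤ σ * f x)
    (hshell : ∀ x ∈ Metric.ball y₀ ρ, r₀ ≤ dist x x₀ ∧ dist x x₀ ≤ R) {β : ℝ} (hβ : 2 * R < β) :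
    ∀ᶠ τ : ℝ in atTop, ∀ v, IsReducedSolution (fun _ => 1) τ f v →
      Real.exp (-τ * β) ≤ ∫ x in Metric.ball x₀ r₀, ‖grad v x‖ ^ 2 := by
  simp only [dist_eq_norm] at hshell
  have hr₀R : r₀ ≤ R :=
    (hshell y₀ (Metric.mem_ball_self hρ)).1.trans (hshell y₀ (Metric.mem_ball_self hρ)).2
  -- The error `Δ z - τ² z` of the cut-off kernel `z` lives on two shells: the inner one lies in
  -- `closedBall x₀ (r₀ / 2)`, and on the outer one `e^{-2τ|x - x₀|} ≤ e^{-τβ}` with `2 R < β`.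
  let χ : ContDiffBump ((r₀ / 2 + β / 2) / 2) :=
    ⟨(β / 2 - r₀ / 2) / 2, (β / 2 - r₀ / 2) / 2 + r₀ / 4, by linarith, by linarith⟩
  have hinner : (r₀ / 2 + β / 2) / 2 - χ.rIn = r₀ / 2 := by
    change (r₀ / 2 + β / 2) / 2 - (β / 2 - r₀ / 2) / 2 = r₀ / 2
    ring
  have houter : 2 * ((r₀ / 2 + β / 2) / 2 + χ.rIn) = β := by
    change 2 * ((r₀ / 2 + β / 2) / 2 + (β / 2 - r₀ / 2) / 2) = β
    ring
  have hχ : χ.rOut < (r₀ / 2 + β / 2) / 2 := by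
    change (β / 2 - r₀ / 2) / 2 + r₀ / 4 < (r₀ / 2 + β / 2) / 2
    linarith
  have hin : ∀ x ∈ Metric.ball y₀ ρ, |‖x - x₀‖ - (r₀ / 2 + β / 2) / 2| ≤ χ.rIn := fun x hx =>
    abs_le.2 ⟨by linarith [hshell x hx], by linarith [hshell x hx]⟩
  obtain ⟨κ, hκ, hlower⟩ := exists_mul_exp_le_sq_integral_mul_cutoffYukawa χ hχ hρ
    (hr₀.trans_le hr₀R) hc₁ hσ hfσ hfc (fun x hx => hr₀.trans_le (hshell x hx).1)
    (fun x hx => (hshell x hx).2) hin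
  obtain ⟨C, hC, hupper⟩ := exists_sq_integral_mul_cutoffYukawa_le χ hχ x₀ f
  obtain ⟨C', hC', hcaccioppoli⟩ :=
    exists_setIntegral_norm_sq_toL2_le x₀ (half_pos hr₀) (half_lt_self hr₀)
  rw [hinner, houter] at hupper
  filter_upwards [eventually_exp_neg_mul_le_of_mul_exp_le (C := C * (C' + 1)) hκ (by positivity)
    hβ le_rfl, eventually_ge_atTop 1] with τ hτ hτ1 v hv
  refine hτ _ ((hlower τ (by linarith)).trans ((hupper τ hτ1 v hv).trans ?_))
  have hA : 0 ≤ ∫ x in Metric.ball x₀ r₀, ‖grad v x‖ ^ 2 := integral_nonneg fun x => sq_nonneg _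
  rw [mul_right_comm C (C' + 1), mul_assoc (C * τ ^ 2)]
  gcongr
  nlinarith [hcaccioppoli τ f v hτ1 hv hf₀, mul_nonneg hC' (Real.exp_pos (-τ * β)).le]

end LowerBound

/-! ### Geometry of the inclusion and of the emission set -/

/-- Near a density point of `S` no ball of comparable radius can miss `S`. -/
theorem measure_eq_zero_of_eventually_disjoint_closedBall {α : Type*} [PseudoMetricSpace α]
    [SecondCountableTopology α] [MeasurableSpace α] [BorelSpace α] {μ : Measure α}
    [IsUnifLocDoublingMeasure μ] [IsLocallyFiniteMeasure μ] {S : Set α} (hS : MeasurableSet S)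
    (hporous : ∀ x ∈ S, ∃ K : ℝ, ∀ᶠ r in 𝓝[>] (0 : ℝ),
      ∃ y, dist x y ≤ K * r ∧ Disjoint S (Metric.closedBall y r)) : μ S = 0 := by
  have hdensity : ∀ᵐ x ∂μ, ∀ N : ℕ, x ∈ S → ∀ w : ℝ → α,
      (∀ᶠ r in 𝓝[>] (0 : ℝ), x ∈ Metric.closedBall (w r) (N * r)) →
      Tendsto (fun r => μ (S ∩ Metric.closedBall (w r) r) / μ (Metric.closedBall (w r) r))
        (𝓝[>] 0) (𝓝 1) := by
    refine ae_all_iff.2 fun N => (ae_restrict_iff' hS).1 ?_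
    filter_upwards [IsUnifLocDoublingMeasure.ae_tendsto_measure_inter_div μ S N] with x hx w hw
    exact hx w id tendsto_id hw
  rw [measure_eq_zero_iff_ae_notMem]
  filter_upwards [hdensity] with x hx hxS
  obtain ⟨K, hK⟩ := hporous x hxS
  obtain ⟨N, hN⟩ := exists_nat_ge K
  obtain ⟨w, hw⟩ := hK.choice
  have hlim := hx N hxS w (by
    filter_upwards [hw, self_mem_nhdsWithin] with r hr hr₀
    exact hr.1.trans (mul_le_mul_of_nonneg_right hN (mem_Ioi.1 hr₀).le))
  refine zero_ne_one (tendsto_nhds_unique ((tendsto_congr' ?_).1 tendsto_const_nhds) hlim)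
  filter_upwards [hw] with r hr
  rw [hr.2.inter_eq, measure_empty, ENNReal.zero_div]

theorem exists_ball_subset_cone_diff (x : E3) {n : E3} {h θ : ℝ} (hn : ‖n‖ = 1) (hθ₀ : 0 < θ)
    (hθ : θ ≤ Real.pi) :
    ∃ σ, 0 < σ ∧ ∀ s, 0 < s → 2 * s ≤ h →
      Metric.ball (x + s • n) (s * σ) ⊆ cone x n h θ \ {x} := by
  have hcos : Real.cos θ < 1 := by
    simpa only [Real.cos_zero] using Real.cos_lt_cos_of_nonneg_of_le_pi le_rfl hθ hθ₀
  have hcos' : -1 ≤ Real.cos θ := Real.neg_one_le_cos θ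
  refine ⟨(1 - Real.cos θ) / 3, by linarith, fun s hs hsh y hy => ?_⟩
  set k := Real.cos θ
  have hw : ‖y - (x + s • n)‖ < s * ((1 - k) / 3) := by rwa [← dist_eq_norm]
  have hyx : y - x = s • n + (y - (x + s • n)) := by abel
  have hnorm : ‖y - x‖ ≤ s + s * ((1 - k) / 3) := by
    rw [hyx]
    refine (norm_add_le _ _).trans (add_le_add (le_of_eq ?_) hw.le)
    rw [norm_smul, hn, mul_one, Real.norm_of_nonneg hs.le]
  have hinner : s - s * ((1 - k) / 3) ≤ inner ℝ (y - x) n := by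
    rw [hyx, inner_add_left, real_inner_smul_left, real_inner_self_eq_norm_sq, hn]
    have hcs := neg_le_of_abs_le (abs_real_inner_le_norm (y - (x + s • n)) n)
    rw [hn, mul_one] at hcs
    linarith
  have hpos : 0 < s - s * ((1 - k) / 3) := by nlinarith
  refine ⟨⟨by nlinarith, le_trans ?_ hinner⟩, ?_⟩
  · rcases le_or_gt k 0 with hk | hk
    · exact (mul_nonpos_of_nonneg_of_nonpos (norm_nonneg _) hk).trans hpos.le
    · refine (mul_le_mul_of_nonneg_right hnorm hk.le).trans ?_
      nlinarith [mul_nonneg hs.le (sq_nonneg (1 - k))]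
  · rintro rfl
    rw [sub_self, inner_zero_left] at hinner
    linarith

theorem ConeCondition.exists_ball_subset {A : Set E3} (hA : ConeCondition A) {x : E3}
    (hx : x ∈ frontier A) :
    ∃ (n : E3) (h σ : ℝ), ‖n‖ = 1 ∧ 0 < h ∧ 0 < σ ∧
      ∀ s, 0 < s → 2 * s ≤ h → Metric.ball (x + s • n) (s * σ) ⊆ A := by
  obtain ⟨n, h, θ, hn, hh, hθ₀, hθ, hcone⟩ := hA x hx
  obtain ⟨σ, hσ, hball⟩ := exists_ball_subset_cone_diff x hn hθ₀ hθ
  exact ⟨n, h, σ, hn, hh, hσ, fun s hs hsh => (hball s hs hsh).trans hcone⟩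

theorem ConeCondition.volume_frontier {B : Set E3} (hC : ConeCondition B) (hB : IsOpen B) :
    volume (frontier B) = 0 := by
  refine measure_eq_zero_of_eventually_disjoint_closedBall measurableSet_frontier fun x hx => ?_
  obtain ⟨n, h, σ, hn, hh, hσ, hball⟩ := hC.exists_ball_subset hx
  refine ⟨2 / σ, ?_⟩
  filter_upwards [Ioo_mem_nhdsGT (by positivity : 0 < h * σ / 4)] with r hr
  have hs : 0 < 2 / σ * r := mul_pos (by positivity) hr.1
  have hsub : Metric.closedBall (x + (2 / σ * r) • n) r ⊆ B := by
    refine (Metric.closedBall_subset_ball ?_).trans (hball (2 / σ * r) hs ?_)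
    · rw [mul_right_comm, div_mul_cancel₀ _ hσ.ne']
      linarith [hr.1]
    · calc 2 * (2 / σ * r) ≤ 2 * (2 / σ * (h * σ / 4)) := by
            gcongr
            exact hr.2.le
        _ = h := by
            field_simp
            norm_num
  refine ⟨x + (2 / σ * r) • n, le_of_eq ?_, ?_⟩
  · rw [dist_self_add_right, norm_smul, hn, mul_one, Real.norm_of_nonneg hs.le]
  · rw [hB.frontier_eq]
    exact disjoint_sdiff_left.mono_right hsub

theorem ConeCondition.frontier_subset_closure_interior {A : Set E3} (hA : ConeCondition A) :
    frontier A ⊆ closure (interior A) := by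
  intro x hx
  obtain ⟨n, h, σ, hn, hh, hσ, hball⟩ := hA.exists_ball_subset hx
  rw [Metric.mem_closure_iff]
  intro ε hε
  have hs : 0 < min (ε / 2) (h / 2) := lt_min (by linarith) (by linarith)
  refine ⟨x + min (ε / 2) (h / 2) • n, ?_, ?_⟩
  · have hsh : 2 * min (ε / 2) (h / 2) ≤ h := by linarith [min_le_right (ε / 2) (h / 2)]
    exact interior_maximal (hball _ hs hsh) Metric.isOpen_ball
      (Metric.mem_ball_self (by positivity))
  · rw [dist_self_add_right, norm_smul, hn, mul_one, Real.norm_of_nonneg hs.le]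
    linarith [min_le_left (ε / 2) (h / 2)]

/-- Away from `closure (interior D)` a defining function is nonnegative, so a boundary point there
would be a local minimum of it. -/
theorem HasC1Boundary.frontier_subset_closure_interior {D : Set E3} (hD : HasC1Boundary D) :
    frontier D ⊆ closure (interior D) := by
  intro x hx
  obtain ⟨r, g, hr, hg, hdg, hgD⟩ := hD x hx
  by_contra hcl
  have hcont : ∀ y ∈ Metric.ball x r, ContinuousAt g y := fun y hy =>
    hg.continuousOn.continuousAt (Metric.isOpen_ball.mem_nhds hy)
  have hxr : x ∈ Metric.ball x r := Metric.mem_ball_self hr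
  have hgx : g x ≤ 0 := by
    by_contra! hpos
    obtain ⟨y, hyD, hy, hyr⟩ := ((mem_closure_iff_frequently.1 hx.1).and_eventually
      (((hcont x hxr).eventually (lt_mem_nhds hpos)).and (Metric.ball_mem_nhds x hr))).exists
    exact (hgD y hyr).2 hy hyD
  have hmin : IsLocalMin g x := by
    filter_upwards [isClosed_closure.isOpen_compl.mem_nhds hcl, Metric.ball_mem_nhds x hr]
      with y hy hyr
    refine hgx.trans (le_of_not_gt fun hneg => hy (subset_closure ?_))
    rw [mem_interior_iff_mem_nhds]
    filter_upwards [(hcont y hyr).eventually (gt_mem_nhds hneg), Metric.isOpen_ball.mem_nhds hyr]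
      with z hz hzr
    exact (hgD z hzr).1 hz
  exact hdg x hxr hmin.fderiv_eq_zero

theorem subset_closure_interior_of_frontier_subset {X : Type*} [TopologicalSpace X] {A : Set X}
    (hA : frontier A ⊆ closure (interior A)) : A ⊆ closure (interior A) :=
  subset_closure.trans
    (closure_eq_interior_union_frontier A ▸ union_subset subset_closure hA)

theorem setDist_le_dist {D B : Set E3} {x y : E3} (hx : x ∈ closure D) (hy : y ∈ closure B) :
    setDist D B ≤ dist x y := by
  have hmaps : ∀ p ∈ closure (D ×ˢ B), setDist D B ≤ dist p.1 p.2 := by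
    refine fun p hp => closure_minimal (fun p hp => ?_)
      (isClosed_le continuous_const continuous_dist) hp
    rw [mem_ofPred_eq, setDist]
    refine csInf_le ⟨0, ?_⟩ ⟨p.1, hp.1, p.2, hp.2, rfl⟩
    rintro _ ⟨_, _, _, _, rfl⟩
    exact dist_nonneg
  rw [closure_prod_eq] at hmaps
  exact hmaps (x, y) ⟨hx, hy⟩

theorem exists_mem_interior_dist_lt {D B : Set E3} (hD : D.Nonempty) (hB : B.Nonempty)
    (hD_reg : D ⊆ closure (interior D)) {R : ℝ} (hR : setDist D B < R) :
    ∃ x ∈ interior D, ∃ y ∈ B, dist x y < R := by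
  obtain ⟨x₀, hx₀⟩ := hD
  obtain ⟨y₀, hy₀⟩ := hB
  obtain ⟨_, ⟨x, hx, y, hy, rfl⟩, hlt⟩ :=
    exists_lt_of_csInf_lt (s := {r | ∃ x ∈ D, ∃ y ∈ B, r = dist x y}) ⟨_, x₀, hx₀, y₀, hy₀, rfl⟩ hR
  obtain ⟨x', hx', hxx'⟩ := Metric.mem_closure_iff.1 (hD_reg hx) (R - dist x y) (by linarith)
  exact ⟨x', hx', y, hy, by linarith [dist_triangle x' x y, dist_comm x x']⟩

theorem EmissionCondition.exists_sign {B : Set E3} {f : L2} (hf : EmissionCondition B f)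
    (hB : volume (frontier B) = 0) :
    ∃ c₁ σ : ℝ, 0 < c₁ ∧ σ ^ 2 = 1 ∧ (∀ᵐ x, 0 ≤ σ * f x) ∧ ∀ᵐ x, x ∈ B → c₁ ≤ σ * f x := by
  obtain ⟨hsupp, c₁, hc₁, hsign⟩ := hf
  obtain ⟨σ, hσ, hpos⟩ : ∃ σ : ℝ, σ ^ 2 = 1 ∧ ∀ᵐ x, x ∈ B → c₁ ≤ σ * f x := by
    rcases hsign with hf | hf
    · exact ⟨1, one_pow 2, by simpa only [one_mul] using hf⟩
    · exact ⟨-1, neg_one_sq, by simpa only [neg_one_mul] using hf⟩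
  refine ⟨c₁, σ, hc₁, hσ, ?_, hpos⟩
  filter_upwards [hsupp, hpos, measure_eq_zero_iff_ae_notMem.1 hB] with x hout hin hfr
  by_cases hx : x ∈ closure B
  · have hxB : x ∈ B := by_contra fun h => hfr ⟨hx, fun hi => h (interior_subset hi)⟩
    exact hc₁.le.trans (hin hxB)
  · rw [hout hx, mul_zero]

section EnergyDecay

variable {D B : Set E3} {f : L2} {β : ℝ}

theorem exists_setIntegral_closure_norm_sq_grad_le (hD : Bornology.IsBounded D)
    (hf : ∀ᵐ x, x ∉ closure B → f x = 0) (hβ : β < 2 * setDist D B) :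
    ∃ C, ∀ τ, 1 ≤ τ → ∀ v, IsReducedSolution (fun _ => 1) τ f v →
      ∫ x in closure D, ‖grad v x‖ ^ 2 ≤ C * Real.exp (-τ * β) := by
  refine exists_setIntegral_norm_sq_grad_le hD.isCompact_closure hβ fun x₀ hx₀ => ?_
  filter_upwards [hf] with x hx
  by_cases hxB : x ∈ closure B
  · exact Or.inr (dist_comm x x₀ ▸ setDist_le_dist hx₀ hxB)
  · exact Or.inl (hx hxB)

theorem exists_subset_eventually_exp_le_setIntegral (hD : D.Nonempty) (hB : B.Nonempty)
    (hB_open : IsOpen B) (hBD : Disjoint (closure B) (closure D))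
    (hD_reg : D ⊆ closure (interior D)) (hB_null : volume (frontier B) = 0)
    (hf : EmissionCondition B f) (hβ : 2 * setDist D B < β) :
    ∃ S ⊆ D, MeasurableSet S ∧ ∀ᶠ τ : ℝ in atTop, ∀ v, IsReducedSolution (fun _ => 1) τ f v →
      Real.exp (-τ * β) ≤ ∫ x in S, ‖grad v x‖ ^ 2 := by
  obtain ⟨c₁, σ, hc₁, hσ, hfσ, hfc⟩ := hf.exists_sign hB_null
  obtain ⟨R, hdR, hRβ⟩ := exists_between (by linarith : setDist D B < β / 2)
  obtain ⟨x₀, hx₀, y₀, hy₀, hxy⟩ := exists_mem_interior_dist_lt hD hB hD_reg hdR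
  obtain ⟨r₀, hr₀, hr₀D⟩ := Metric.mem_nhds_iff.1 (mem_interior_iff_mem_nhds.1 hx₀)
  obtain ⟨ρ, hρ, hρB⟩ := Metric.mem_nhds_iff.1 (Filter.inter_mem (hB_open.mem_nhds hy₀)
    (Metric.ball_mem_nhds y₀ (sub_pos.2 hxy)))
  have hdisj : ∀ x ∈ closure B, x ∉ Metric.ball x₀ r₀ := fun x hxB hx =>
    hBD.notMem_of_mem_left hxB (subset_closure (hr₀D hx))
  refine ⟨Metric.ball x₀ r₀, hr₀D, measurableSet_ball,
    eventually_exp_le_setIntegral_norm_sq_grad hr₀ hρ hc₁ hσ ?_ hfσ ?_ (R := R) (y₀ := y₀) ?_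
      (by linarith)⟩
  · filter_upwards [hf.1] with x hx hxb
    exact hx fun hxB => hdisj x hxB hxb
  · filter_upwards [hfc] with x hx hxb
    exact hx (hρB hxb).1
  · refine fun x hx => ⟨le_of_not_gt fun h => hdisj x (subset_closure (hρB hx).1) h, ?_⟩
    have hxy₀ := Metric.mem_ball.1 (hρB hx).2
    linarith [dist_triangle x y₀ x₀, dist_comm x₀ y₀]

end EnergyDecay

/-! ### Asymptotics of the indicator function -/

section Contrast

variable {γ : E3 → Matrix (Fin 3) (Fin 3) ℝ} {D S : Set E3} {c k : ℝ}

theorem ae_indicator_mul_norm_sq_le_of_le (hc : 0 < c) (hγ_out : ∀ᵐ x : E3, x ∉ D → γ x = 1)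
    (hγ_in : ∀ᵐ x : E3, x ∈ D → ∀ ξ : E3, c * ‖ξ‖ ^ 2 ≤ (γ x *ᵥ ξ.ofLp) ⬝ᵥ ξ.ofLp)
    (hk : ∀ x, S.indicator (fun _ => k) x ≤ D.indicator (fun _ => 1 - 1 / c) x) :
    ∀ᵐ x : E3, ∀ p q : E3, S.indicator (fun _ => k) x * ‖q‖ ^ 2
      ≤ ‖p - q‖ ^ 2 + ((γ x *ᵥ p.ofLp) ⬝ᵥ p.ofLp - ‖p‖ ^ 2) := by
  filter_upwards [hγ_out, hγ_in] with x hx_out hx_in p q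
  refine (mul_le_mul_of_nonneg_right (hk x) (sq_nonneg _)).trans ?_
  by_cases hx : x ∈ D
  · rw [indicator_of_mem hx]
    exact (norm_sub_sq_add_ge p q hc).trans (by linarith [hx_in hx p])
  · rw [indicator_of_notMem hx, hx_out hx, Matrix.one_mulVec, dotProduct_eq_inner,
      real_inner_self_eq_norm_sq, zero_mul, sub_self, add_zero]
    positivity

theorem ae_indicator_mul_norm_sq_le_of_ge (hγ_out : ∀ᵐ x : E3, x ∉ D → γ x = 1)
    (hγ_in : ∀ᵐ x : E3, x ∈ D → ∀ ξ : E3, (γ x *ᵥ ξ.ofLp) ⬝ᵥ ξ.ofLp ≤ c * ‖ξ‖ ^ 2)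
    (hk : ∀ x, S.indicator (fun _ => k) x ≤ D.indicator (fun _ => 1 - c) x) :
    ∀ᵐ x : E3, ∀ q : E3, S.indicator (fun _ => k) x * ‖q‖ ^ 2
      ≤ ‖q‖ ^ 2 - (γ x *ᵥ q.ofLp) ⬝ᵥ q.ofLp := by
  filter_upwards [hγ_out, hγ_in] with x hx_out hx_in q
  refine (mul_le_mul_of_nonneg_right (hk x) (sq_nonneg _)).trans ?_
  by_cases hx : x ∈ D
  · rw [indicator_of_mem hx]
    linarith [hx_in hx q]
  · rw [indicator_of_notMem hx, hx_out hx, Matrix.one_mulVec, dotProduct_eq_inner,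
      real_inner_self_eq_norm_sq, zero_mul, sub_self]

theorem indicator_const_le_indicator_const_of_nonneg (hS : S ⊆ D) (hk : 0 ≤ k) (x : E3) :
    S.indicator (fun _ => k) x ≤ D.indicator (fun _ => k) x :=
  indicator_le_indicator_of_subset hS (fun _ => hk) x

theorem indicator_const_le_indicator_const_of_nonpos (hD : D ⊆ S) (hk : k ≤ 0) (x : E3) :
    S.indicator (fun _ => k) x ≤ D.indicator (fun _ => k) x := by
  by_cases hx : x ∈ D
  · rw [indicator_of_mem hx, indicator_of_mem (hD hx)]
  · rw [indicator_of_notMem hx]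
    exact indicator_nonpos (fun _ _ => hk) x

end Contrast

section Sandwich

variable {γ : E3 → Matrix (Fin 3) (Fin 3) ℝ} {T : ℝ} {f : L2} {u v : ℝ → H1} {D : Set E3}

theorem IsWeakWaveSolution.exists_abs_indicatorFn_le (hu : IsWeakWaveSolution γ T f u)
    (hγ : IsCoefficient γ) (hT : 0 < T)
    (hv : ∀ τ : ℝ, 1 ≤ τ → IsReducedSolution (fun _ => 1) τ f (v τ))
    (hγ_out : ∀ᵐ x : E3, x ∉ D → γ x = 1) :
    ∃ C K : ℝ, 0 ≤ C ∧ ∀ τ : ℝ, 1 ≤ τ → |indicatorFn T f u v τ|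
      ≤ C * (∫ x in closure D, ‖grad (v τ) x‖ ^ 2) + K / τ * Real.exp (-τ * T) := by
  obtain ⟨K, hK⟩ := hu.exists_mul_setIntegral_le hγ hT hv
  obtain ⟨c, hc, hγc⟩ := hγ.elliptic
  obtain ⟨M, -, hγM⟩ := hγ.exists_abs_le
  have hmin : 0 < min c 1 := lt_min hc one_pos
  have hlow : 1 - 1 / min c 1 ≤ 0 := sub_nonpos.2 (one_le_one_div hmin (min_le_right _ _))
  have hupp : 1 - max M 1 ≤ 0 := sub_nonpos.2 (le_max_right _ _)
  have hγ_ge : ∀ᵐ x : E3, x ∈ D → ∀ ξ : E3,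
      min c 1 * ‖ξ‖ ^ 2 ≤ (γ x *ᵥ ξ.ofLp) ⬝ᵥ ξ.ofLp := by
    filter_upwards [hγc] with x hx _ ξ
    exact (mul_le_mul_of_nonneg_right (min_le_left _ _) (sq_nonneg _)).trans (hx ξ)
  have hγ_le : ∀ᵐ x : E3, x ∈ D → ∀ ξ : E3,
      (γ x *ᵥ ξ.ofLp) ⬝ᵥ ξ.ofLp ≤ max M 1 * ‖ξ‖ ^ 2 := by
    filter_upwards [hγM] with x hx _ ξ
    rw [sq]
    exact (le_of_abs_le (hx ξ ξ)).trans
      (mul_le_mul_of_nonneg_right (le_max_left _ _) (by positivity))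
  have hneg := (hK (closure D) _ measurableSet_closure).1
    (ae_indicator_mul_norm_sq_le_of_le hmin hγ_out hγ_ge
      (indicator_const_le_indicator_const_of_nonpos subset_closure hlow))
  have hpos := (hK (closure D) _ measurableSet_closure).2
    (ae_indicator_mul_norm_sq_le_of_ge hγ_out hγ_le
      (indicator_const_le_indicator_const_of_nonpos subset_closure hupp))
  refine ⟨(1 / min c 1 - 1) + (max M 1 - 1), K, by linarith, fun τ hτ => abs_le.2 ?_⟩
  have hint : 0 ≤ ∫ x in closure D, ‖grad (v τ) x‖ ^ 2 := integral_nonneg fun _ => sq_nonneg _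
  have := mul_nonpos_of_nonpos_of_nonneg hlow hint
  have := mul_nonpos_of_nonpos_of_nonneg hupp hint
  constructor <;> linarith [hneg τ hτ, hpos τ hτ]

theorem MonotonePlus.exists_mul_setIntegral_le (hM : MonotonePlus γ D)
    (hu : IsWeakWaveSolution γ T f u) (hγ : IsCoefficient γ) (hT : 0 < T)
    (hv : ∀ τ : ℝ, 1 ≤ τ → IsReducedSolution (fun _ => 1) τ f (v τ))
    (hγ_out : ∀ᵐ x : E3, x ∉ D → γ x = 1) :
    ∃ k K : ℝ, 0 < k ∧ ∀ S ⊆ D, MeasurableSet S → ∀ τ : ℝ, 1 ≤ τ →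
      k * ∫ x in S, ‖grad (v τ) x‖ ^ 2
        ≤ -indicatorFn T f u v τ + K / τ * Real.exp (-τ * T) := by
  obtain ⟨K, hK⟩ := hu.exists_mul_setIntegral_le hγ hT hv
  obtain ⟨c, hc, hγ_in⟩ := hM
  have hk : 0 < 1 - 1 / c := sub_pos.2 (by simpa using inv_lt_one_of_one_lt₀ hc)
  exact ⟨1 - 1 / c, K, hk, fun S hSD hS => (hK S _ hS).1
    (ae_indicator_mul_norm_sq_le_of_le (one_pos.trans hc) hγ_out hγ_in
      (indicator_const_le_indicator_const_of_nonneg hSD hk.le))⟩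

theorem MonotoneMinus.exists_mul_setIntegral_le (hM : MonotoneMinus γ D)
    (hu : IsWeakWaveSolution γ T f u) (hγ : IsCoefficient γ) (hT : 0 < T)
    (hv : ∀ τ : ℝ, 1 ≤ τ → IsReducedSolution (fun _ => 1) τ f (v τ))
    (hγ_out : ∀ᵐ x : E3, x ∉ D → γ x = 1) :
    ∃ k K : ℝ, 0 < k ∧ ∀ S ⊆ D, MeasurableSet S → ∀ τ : ℝ, 1 ≤ τ →
      k * ∫ x in S, ‖grad (v τ) x‖ ^ 2
        ≤ indicatorFn T f u v τ + K / τ * Real.exp (-τ * T) := by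
  obtain ⟨K, hK⟩ := hu.exists_mul_setIntegral_le hγ hT hv
  obtain ⟨c, hc, hγ_in⟩ := hM
  exact ⟨1 - c, K, sub_pos.2 hc, fun S hSD hS => (hK S _ hS).2
    (ae_indicator_mul_norm_sq_le_of_ge hγ_out hγ_in
      (indicator_const_le_indicator_const_of_nonneg hSD (sub_nonneg.2 hc.le)))⟩

end Sandwich

section ExponentialScale

variable {I J : ℝ → ℝ} {C K k ℓ s T β : ℝ}

theorem exp_mul_mul_exp_neg_mul (τ s β : ℝ) :
    Real.exp (τ * s) * Real.exp (-τ * β) = Real.exp (τ * (s - β)) := by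
  rw [← Real.exp_add]
  ring_nf

theorem tendsto_div_mul_exp_mul_atTop_zero (K : ℝ) (hs : s ≤ 0) :
    Tendsto (fun τ : ℝ => K / τ * Real.exp (τ * s)) atTop (𝓝 0) := by
  refine squeeze_zero_norm' ?_ (tendsto_const_nhds.div_atTop tendsto_id :
    Tendsto (fun τ : ℝ => |K| / τ) atTop (𝓝 0))
  filter_upwards [eventually_gt_atTop 0] with τ hτ
  rw [norm_mul, norm_div, Real.norm_of_nonneg hτ.le, Real.norm_of_nonneg (Real.exp_pos _).le,
    Real.norm_eq_abs]
  exact mul_le_of_le_one_right (by positivity)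
    (Real.exp_le_one_iff.2 (mul_nonpos_of_nonneg_of_nonpos hτ.le hs))

theorem tendsto_exp_mul_mul_nhds_zero (hsT : s ≤ T) (hsβ : s < β)
    (hI : ∀ τ : ℝ, 1 ≤ τ → |I τ| ≤ C * Real.exp (-τ * β) + K / τ * Real.exp (-τ * T)) :
    Tendsto (fun τ : ℝ => Real.exp (τ * s) * I τ) atTop (𝓝 0) := by
  have hdecay : Tendsto (fun τ : ℝ => Real.exp (τ * (s - β))) atTop (𝓝 0) :=
    Real.tendsto_exp_atBot.comp (tendsto_id.atTop_mul_const_of_neg (sub_neg.2 hsβ))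
  have hbound := (hdecay.const_mul C).add
    (tendsto_div_mul_exp_mul_atTop_zero K (sub_nonpos.2 hsT))
  rw [mul_zero, add_zero] at hbound
  refine squeeze_zero_norm' ?_ hbound
  filter_upwards [eventually_ge_atTop 1] with τ hτ
  rw [norm_mul, Real.norm_of_nonneg (Real.exp_pos _).le, ← exp_mul_mul_exp_neg_mul,
    ← exp_mul_mul_exp_neg_mul]
  calc Real.exp (τ * s) * ‖I τ‖
      ≤ Real.exp (τ * s) * (C * Real.exp (-τ * β) + K / τ * Real.exp (-τ * T)) := by
        gcongr
        exact hI τ hτ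
    _ = _ := by ring

theorem tendsto_exp_mul_mul_atTop (hsT : s ≤ T) (hβs : β < s) (hk : 0 < k)
    (hJ : ∀ᶠ τ : ℝ in atTop, k * Real.exp (-τ * β) ≤ J τ + K / τ * Real.exp (-τ * T)) :
    Tendsto (fun τ : ℝ => Real.exp (τ * s) * J τ) atTop atTop := by
  have hgrowth : Tendsto (fun τ : ℝ => Real.exp (τ * (s - β))) atTop atTop :=
    Real.tendsto_exp_atTop.comp (tendsto_id.atTop_mul_const (sub_pos.2 hβs))
  have hbound := (hgrowth.const_mul_atTop hk).atTop_add
    (tendsto_div_mul_exp_mul_atTop_zero K (sub_nonpos.2 hsT)).neg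
  refine tendsto_atTop_mono' _ ?_ hbound
  filter_upwards [hJ] with τ hτ
  have := mul_le_mul_of_nonneg_left hτ (Real.exp_pos (τ * s)).le
  rw [← exp_mul_mul_exp_neg_mul, ← exp_mul_mul_exp_neg_mul]
  linarith

theorem tendsto_one_div_mul_log_abs (hℓ : ℓ < T)
    (hsmall : ∀ s < ℓ, Tendsto (fun τ : ℝ => Real.exp (τ * s) * I τ) atTop (𝓝 0))
    (hlarge : ∀ s, ℓ < s → s ≤ T →
      Tendsto (fun τ : ℝ => Real.exp (τ * s) * |I τ|) atTop atTop) :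
    Tendsto (fun τ : ℝ => 1 / τ * Real.log |I τ|) atTop (𝓝 (-ℓ)) := by
  have hne : ∀ᶠ τ : ℝ in atTop, 0 < |I τ| := by
    filter_upwards [(hlarge T hℓ le_rfl).eventually_gt_atTop 0] with τ hτ
    exact pos_of_mul_pos_right hτ (Real.exp_pos _).le
  rw [tendsto_order]
  constructor <;> intro a ha
  · have has : ℓ < min (-a) T := lt_min (lt_neg_of_lt_neg ha) hℓ
    filter_upwards [(hlarge _ has (min_le_right _ _)).eventually_gt_atTop 1, hne,
      eventually_gt_atTop 0] with τ hτ hI hτ0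
    have hlog : -(τ * min (-a) T) < Real.log |I τ| := by
      have := Real.log_pos hτ
      rw [Real.log_mul (Real.exp_pos _).ne' hI.ne', Real.log_exp] at this
      linarith
    rw [one_div, lt_inv_mul_iff₀ hτ0]
    nlinarith [mul_le_mul_of_nonneg_left (min_le_left (-a) T) hτ0.le]
  · filter_upwards [(hsmall (-a) (by linarith)).abs.eventually_lt_const (by simp : |(0:ℝ)| < 1),
      hne, eventually_gt_atTop 0] with τ hτ hI hτ0
    have hlog : Real.log |I τ| < τ * a := by
      rw [abs_mul, Real.abs_exp] at hτ
      have := Real.log_neg (by positivity) hτ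
      rw [Real.log_mul (Real.exp_pos _).ne' hI.ne', Real.log_exp] at this
      linarith
    rwa [one_div, inv_mul_lt_iff₀ hτ0]

end ExponentialScale

theorem tendsto_exp_mul_atTop_of_mul_setIntegral_le {D B : Set E3} {f : L2} {v : ℝ → H1}
    {J : ℝ → ℝ} {k K s T : ℝ} (hD_ne : D.Nonempty) (hB_ne : B.Nonempty) (hB_open : IsOpen B)
    (hBD : Disjoint (closure B) (closure D)) (hD_reg : D ⊆ closure (interior D))
    (hB_null : volume (frontier B) = 0) (hf : EmissionCondition B f)
    (hv : ∀ τ : ℝ, 1 ≤ τ → IsReducedSolution (fun _ => 1) τ f (v τ)) (hk : 0 < k)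
    (hJ : ∀ S ⊆ D, MeasurableSet S → ∀ τ : ℝ, 1 ≤ τ →
      k * ∫ x in S, ‖grad (v τ) x‖ ^ 2 ≤ J τ + K / τ * Real.exp (-τ * T))
    (hsT : s ≤ T) (hs : 2 * setDist D B < s) :
    Tendsto (fun τ : ℝ => Real.exp (τ * s) * J τ) atTop atTop := by
  obtain ⟨β, hdβ, hβs⟩ := exists_between hs
  obtain ⟨S, hSD, hS, hlow⟩ :=
    exists_subset_eventually_exp_le_setIntegral hD_ne hB_ne hB_open hBD hD_reg hB_null hf hdβ
  refine tendsto_exp_mul_mul_atTop (K := K) hsT hβs hk ?_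
  filter_upwards [hlow, eventually_ge_atTop 1] with τ hτ_low hτ
  exact (mul_le_mul_of_nonneg_left (hτ_low _ (hv τ hτ)) hk.le).trans (hJ S hSD hS τ hτ)

theorem IsWeakWaveSolution.tendsto_exp_mul_indicatorFn_nhds_zero
    {γ : E3 → Matrix (Fin 3) (Fin 3) ℝ} {D B : Set E3} {f : L2} {u v : ℝ → H1} {s T : ℝ}
    (hu : IsWeakWaveSolution γ T f u) (hγ : IsCoefficient γ) (hT : 0 < T)
    (hv : ∀ τ : ℝ, 1 ≤ τ → IsReducedSolution (fun _ => 1) τ f (v τ))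
    (hγ_out : ∀ᵐ x : E3, x ∉ D → γ x = 1) (hD_bdd : Bornology.IsBounded D)
    (hf : ∀ᵐ x : E3, x ∉ closure B → f x = 0) (hsT : s ≤ T) (hs : s < 2 * setDist D B) :
    Tendsto (fun τ : ℝ => Real.exp (τ * s) * indicatorFn T f u v τ) atTop (𝓝 0) := by
  obtain ⟨β, hsβ, hβd⟩ := exists_between hs
  obtain ⟨A, hA⟩ := exists_setIntegral_closure_norm_sq_grad_le hD_bdd hf hβd
  obtain ⟨C, K, hC, hI⟩ := hu.exists_abs_indicatorFn_le hγ hT hv hγ_out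
  refine tendsto_exp_mul_mul_nhds_zero (C := C * A) (K := K) hsT hsβ fun τ hτ => ?_
  refine (hI τ hτ).trans ?_
  rw [mul_assoc]
  gcongr
  exact hA τ hτ _ (hv τ hτ)

end Enclosure

end

theorem mainTheorem1_general
    (γ : E3 → Matrix (Fin 3) (Fin 3) ℝ) (hγ : IsCoefficient γ)
    (D B : Set E3)
    (hD_ne : D.Nonempty) (hD_bdd : Bornology.IsBounded D) (hD_reg : D ⊆ closure (interior D))
    (hγ_out : ∀ᵐ x : E3, x ∉ D → γ x = 1)
    (hM : MonotonePlus γ D ∨ MonotoneMinus γ D)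
    (hB_ne : B.Nonempty) (hB_open : IsOpen B) (hB_null : volume (frontier B) = 0)
    (hBD : closure B ∩ closure D = ∅)
    (f : L2) (hf : EmissionCondition B f)
    (T : ℝ) (hT : 0 < T)
    (u : ℝ → H1) (hu : IsWeakWaveSolution γ T f u)
    (v : ℝ → H1) (hv : ∀ τ : ℝ, 1 ≤ τ → IsReducedSolution (fun _ => 1) τ f (v τ)) :
    (T < 2 * setDist D B →
      Tendsto (fun τ : ℝ => Real.exp (τ * T) * indicatorFn T f u v τ) atTop (𝓝 0)) ∧
    (2 * setDist D B < T → MonotonePlus γ D →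
      Tendsto (fun τ : ℝ => Real.exp (τ * T) * indicatorFn T f u v τ) atTop atBot) ∧
    (2 * setDist D B < T → MonotoneMinus γ D →
      Tendsto (fun τ : ℝ => Real.exp (τ * T) * indicatorFn T f u v τ) atTop atTop) ∧
    (2 * setDist D B < T →
      Tendsto (fun τ : ℝ => 1 / τ * Real.log |indicatorFn T f u v τ|) atTop
        (𝓝 (-(2 * setDist D B)))) := by
  have hzero {s : ℝ} (hsT : s ≤ T) (hs : s < 2 * setDist D B) :=
    hu.tendsto_exp_mul_indicatorFn_nhds_zero hγ hT hv hγ_out hD_bdd hf.1 hsT hs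
  have hatTop {J : ℝ → ℝ} {k K s : ℝ} (hk : 0 < k) (hJ : ∀ S ⊆ D, MeasurableSet S → ∀ τ : ℝ,
      1 ≤ τ → k * ∫ x in S, ‖grad (v τ) x‖ ^ 2 ≤ J τ + K / τ * Real.exp (-τ * T))
      (hsT : s ≤ T) (hs : 2 * setDist D B < s) :=
    tendsto_exp_mul_atTop_of_mul_setIntegral_le hD_ne hB_ne hB_open
      (disjoint_iff_inter_eq_empty.2 hBD) hD_reg hB_null hf hv hk hJ hsT hs
  have hplus (h : MonotonePlus γ D) {s : ℝ} (hsT : s ≤ T) (hs : 2 * setDist D B < s) :=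
    let ⟨_, _, hk, hJ⟩ := h.exists_mul_setIntegral_le hu hγ hT hv hγ_out
    hatTop hk hJ hsT hs
  have hminus (h : MonotoneMinus γ D) {s : ℝ} (hsT : s ≤ T) (hs : 2 * setDist D B < s) :=
    let ⟨_, _, hk, hJ⟩ := h.exists_mul_setIntegral_le hu hγ hT hv hγ_out
    hatTop hk hJ hsT hs
  refine ⟨hzero le_rfl, fun h hMp => ?_, fun h hMm => hminus hMm le_rfl h, fun h => ?_⟩
  · simpa only [Function.comp_def, mul_neg, neg_neg] using
      tendsto_neg_atTop_atBot.comp (hplus hMp le_rfl h)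
  refine tendsto_one_div_mul_log_abs h (fun s hs => hzero (hs.trans h).le hs) fun s hs hsT => ?_
  rcases hM with hMp | hMm
  · exact tendsto_atTop_mono (fun τ => by gcongr; exact neg_le_abs _) (hplus hMp hsT hs)
  · exact tendsto_atTop_mono (fun τ => by gcongr; exact le_abs_self _) (hminus hMm hsT hs)

theorem mainTheorem1
    (γ : E3 → Matrix (Fin 3) (Fin 3) ℝ) (hγ : IsCoefficient γ)
    (D B : Set E3)
    (hD_ne : D.Nonempty) (hD_bdd : Bornology.IsBounded D) (hD_conn : IsConnected Dᶜ)
    (hγ_out : ∀ᵐ x : E3, x ∉ D → γ x = 1)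
    (hM : MonotonePlus γ D ∨ MonotoneMinus γ D)
    (hB_ne : B.Nonempty) (hB_open : IsOpen B) (hBD : closure B ∩ closure D = ∅)
    (hreg : (HasC1Boundary D ∧ ConeCondition B) ∨
      (ConeCondition D ∧ ConeCondition B ∧ Convex ℝ B))
    (f : L2) (hf : EmissionCondition B f)
    (T : ℝ) (hT : 0 < T)
    (u : ℝ → H1) (hu : IsWeakWaveSolution γ T f u)
    (v : ℝ → H1) (hv : ∀ τ : ℝ, 1 ≤ τ → IsReducedSolution (fun _ => 1) τ f (v τ)) :
    (T < 2 * setDist D B →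
      Tendsto (fun τ : ℝ => Real.exp (τ * T) * indicatorFn T f u v τ) atTop (𝓝 0)) ∧
    (2 * setDist D B < T → MonotonePlus γ D →
      Tendsto (fun τ : ℝ => Real.exp (τ * T) * indicatorFn T f u v τ) atTop atBot) ∧
    (2 * setDist D B < T → MonotoneMinus γ D →
      Tendsto (fun τ : ℝ => Real.exp (τ * T) * indicatorFn T f u v τ) atTop atTop) ∧
    (2 * setDist D B < T →
      Tendsto (fun τ : ℝ => 1 / τ * Real.log |indicatorFn T f u v τ|) atTop
        (𝓝 (-(2 * setDist D B)))) :=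
  mainTheorem1_general γ hγ D B hD_ne hD_bdd
    (subset_closure_interior_of_frontier_subset <| hreg.elim
      (·.1.frontier_subset_closure_interior) (·.1.frontier_subset_closure_interior))
    hγ_out hM hB_ne hB_open
    (hreg.elim (·.2.volume_frontier hB_open) (·.2.1.volume_frontier hB_open))
    hBD f hf T hT u hu v hv
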